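/- Let $X\subset\mathbb P^5_{\mathbb Q}$ be the surface with homogeneous coordinates $[x:y:z:a:b:c]$ given by $$x+y+z=0,\qquad xy+yz+zx=-a^2-b^2-c^2,\qquad xyz=2abc.$$ Then the set $X(\mathbb Q)$ of rational points is Zariski dense in $X$. As a consequence there are infinitely many nontrivial symmetric integral $3\times3$ matrices with zero diagonal and integral eigenvalues, obtained from rational parametrizations. Here, for $$M_{a,b,c}=\begin{pmatrix}0&a&b\\a&0&c\\b&c&0\end{pmatrix},$$ nontrivial means $abc(a^2-b^2)(b^2-c^2)(c^2-a^2)\neq0$. Precisely, let $K=\mathbb Q(t)$ and let $E/K$ be the elliptic curve $$v^2=u\,\bigl(u-8t(t^2-1)\bigr)\bigl(u-(t^2-1)(t+2)^2\bigr),\qquad P=\bigl(2t^3(t+1),\,2t^2(t+1)^2(t-2)^2\bigr)\in E(K).$$ The curve $E$ is a model of the generic fibre of the fibration $[x:y:z:a:b:c]\mapsto[x:a]=[2bc:yz]=[t:1]$ of $X$, that is, of the curve over $K$ given in $\mathbb P^5_K$ by the equations of $X$ together with $x=ta$ and $tyz=2bc$, by means of $$\nu=\tfrac{x-c}{a+b},\quad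 \lambda=(t^2-4)\nu+3t,\quad \mu=t(t^2-4)(z-y)(t\nu^2-2\nu+t)/x,$$ $$u=\tfrac12\bigl(\mu+\lambda^2+t(t^2-1)(t+8)\bigr),\quad v=\tfrac12\bigl(\mu\lambda+\lambda^3+(t^2-1)(t^2-8)\lambda-8t(t^2-1)^2\bigr),$$ the zero point of $E$ corresponding to the section $a+b=c-y=0$. Say that a sextuple $(x,y,z,a,b,c)$ of polynomials in $\mathbb Z[t]$ without nonunit common factor parametrizes the section $nP$ if it satisfies the equations of $X$, $x=ta$ and $tyz=2bc$, and corresponds to the point $nP\in E(K)$ (for $nP\ne0$: $a+b\neq0$, $x\neq0$ and $(u,v)=nP$; for $nP=0$: $a+b=c-y=0$). Call an integral matrix primitive if its entries have no common prime factor. Then: 1. There are infinitely many primitive nontrivial symmetric integral $3\times3$ matrices with zero diagonal all of whose eigenvalues are integers (so infinitely many nontrivial ones, even up to scaling). 2. The section $P$ is parametrized by $[t^2:2-t^2:-2:t:t^2-2:t]$, and the multiples $nP$, $n\in\mathbb Z$, are pairwise distinct. 3. For every $n\in\mathbb Z$ there is a sextuple $(x,y,z,a,b,c)$ in $\mathbb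 Z[t]$ that parametrizes $nP$. For every such sextuple and every integer $m$, the matrix $M_{a(m),b(m),c(m)}$ has characteristic polynomial $(T-x(m))(T-y(m))(T-z(m))$, so its eigenvalues are the integers $x(m),y(m),z(m)$. 4. For all but finitely many $n\in\mathbb Z$ and every sextuple parametrizing $nP$, the matrix $M_{a(m),b(m),c(m)}$ is nontrivial for all but finitely many integers $m$, and there are infinitely many primitive nontrivial symmetric integral matrices with zero diagonal and integral eigenvalues of which a nonzero integral multiple is one of the matrices $M_{a(m),b(m),c(m)}$, $m\in\mathbb Z$. -/

import Mathlib

/-! ### The surface and its rational points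

Homogeneous coordinates on `P^5` are written `[x : y : z : a : b : c]` and indexed by `Fin 6` in
this order. -/

attribute [local instance] MvPolynomial.gradedAlgebra

noncomputable section

/-- A vector `(x, y, z, a, b, c)` satisfies the three equations
`x + y + z = 0`, `xy + yz + zx = -a² - b² - c²`, `xyz = 2abc`. -/
def SatisfiesSurfaceEquations {R : Type*} [CommRing R] (p : Fin 6 → R) : Prop :=
  p 0 + p 1 + p 2 = 0 ∧
  p 0 * p 1 + p 1 * p 2 + p 2 * p 0 = -p 3 ^ 2 - p 4 ^ 2 - p 5 ^ 2 ∧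
  p 0 * p 1 * p 2 = 2 * p 3 * p 4 * p 5

/-- The projective space `P^5` over `ℚ`, as a topological space with the Zariski topology: the
projective spectrum of the polynomial ring in six variables graded by degree. -/
abbrev ProjFive : Type :=
  ProjectiveSpectrum (MvPolynomial.homogeneousSubmodule (Fin 6) ℚ)

/-- The surface `X ⊆ P^5`: the zero locus of the three homogeneous forms
`x + y + z`, `xy + yz + zx + a² + b² + c²`, `xyz - 2abc`. -/
def surfaceX : Set ProjFive :=
  ProjectiveSpectrum.zeroLocus (MvPolynomial.homogeneousSubmodule (Fin 6) ℚ)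
    {MvPolynomial.X 0 + MvPolynomial.X 1 + MvPolynomial.X 2,
     MvPolynomial.X 0 * MvPolynomial.X 1 + MvPolynomial.X 1 * MvPolynomial.X 2
      + MvPolynomial.X 2 * MvPolynomial.X 0
      + MvPolynomial.X 3 ^ 2 + MvPolynomial.X 4 ^ 2 + MvPolynomial.X 5 ^ 2,
     MvPolynomial.X 0 * MvPolynomial.X 1 * MvPolynomial.X 2
      - 2 * MvPolynomial.X 3 * MvPolynomial.X 4 * MvPolynomial.X 5}

/-- The ideal generated by all homogeneous polynomials that vanish at the vector `v`. -/
def pointIdeal (v : Fin 6 → ℚ) : Ideal (MvPolynomial (Fin 6) ℚ) :=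
  Ideal.span {F | (∃ n : ℕ, F.IsHomogeneous n) ∧ MvPolynomial.eval v F = 0}

lemma eval_eq_zero_of_mem_pointIdeal {v : Fin 6 → ℚ} {F : MvPolynomial (Fin 6) ℚ}
    (hF : F ∈ pointIdeal v) : MvPolynomial.eval v F = 0 := by
  have h : pointIdeal v ≤ RingHom.ker (MvPolynomial.eval v) :=
    Ideal.span_le.2 fun G hG => hG.2
  exact h hF

lemma pointIdeal_isHomogeneous (v : Fin 6 → ℚ) :
    (pointIdeal v).IsHomogeneous (MvPolynomial.homogeneousSubmodule (Fin 6) ℚ) := by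
  refine Ideal.homogeneous_span _ _ ?_
  rintro F ⟨⟨n, hn⟩, -⟩
  exact ⟨n, hn⟩

lemma pointIdeal_isPrime (v : Fin 6 → ℚ) : (pointIdeal v).IsPrime := by
  refine (pointIdeal_isHomogeneous v).isPrime_of_homogeneous_mem_or_mem ?_ ?_
  · intro h
    have h1 : (1 : MvPolynomial (Fin 6) ℚ) ∈ pointIdeal v := by rw [h]; trivial
    have h2 := eval_eq_zero_of_mem_pointIdeal h1
    simp at h2
  · rintro F G ⟨m, hm⟩ ⟨n, hn⟩ hFG
    have h := eval_eq_zero_of_mem_pointIdeal hFG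
    rw [map_mul] at h
    rcases mul_eq_zero.1 h with h | h
    · exact Or.inl (Ideal.subset_span ⟨⟨m, hm⟩, h⟩)
    · exact Or.inr (Ideal.subset_span ⟨⟨n, hn⟩, h⟩)

lemma not_irrelevant_le_pointIdeal (v : Fin 6 → ℚ) (hv : v ≠ 0) :
    ¬ HomogeneousIdeal.irrelevant (MvPolynomial.homogeneousSubmodule (Fin 6) ℚ) ≤
      ⟨pointIdeal v, pointIdeal_isHomogeneous v⟩ := by
  intro h
  apply hv
  funext i
  have h1 : (MvPolynomial.X i : MvPolynomial (Fin 6) ℚ) ∈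
      HomogeneousIdeal.irrelevant (MvPolynomial.homogeneousSubmodule (Fin 6) ℚ) :=
    HomogeneousIdeal.mem_irrelevant_of_mem _ (i := 1) one_pos (MvPolynomial.isHomogeneous_X ℚ i)
  have h2 : (MvPolynomial.X i : MvPolynomial (Fin 6) ℚ) ∈ pointIdeal v := h h1
  simpa using eval_eq_zero_of_mem_pointIdeal h2

/-- The rational point `[v₀ : ⋯ : v₅]` of `P^5`, for a nonzero rational vector `v`. -/
def rationalPoint (v : Fin 6 → ℚ) (hv : v ≠ 0) : ProjFive where
  asHomogeneousIdeal := ⟨pointIdeal v, pointIdeal_isHomogeneous v⟩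
  isPrime := pointIdeal_isPrime v
  not_irrelevant_le := not_irrelevant_le_pointIdeal v hv

/-- A point of `P^5` is rational if it is `[v₀ : ⋯ : v₅]` for some nonzero rational vector `v`. -/
def IsRationalPoint (p : ProjFive) : Prop :=
  ∃ (v : Fin 6 → ℚ) (hv : v ≠ 0), p = rationalPoint v hv

/-! ### The matrices -/

/-- The symmetric matrix with zero diagonal and off-diagonal entries `a`, `b`, `c`. -/
def symZeroDiag {R : Type*} [CommRing R] (a b c : R) : Matrix (Fin 3) (Fin 3) R :=
  !![0, a, b; a, 0, c; b, c, 0]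

/-- `q(a,b,c) = abc(a² - b²)(b² - c²)(c² - a²)`; a matrix is trivial when this vanishes. -/
def trivialityPoly {R : Type*} [CommRing R] (a b c : R) : R :=
  a * b * c * (a ^ 2 - b ^ 2) * (b ^ 2 - c ^ 2) * (c ^ 2 - a ^ 2)

/-- Every complex eigenvalue of the integral matrix `M` is an integer. -/
def HasIntegralEigenvalues (M : Matrix (Fin 3) (Fin 3) ℤ) : Prop :=
  ∀ μ : ℂ, Module.End.HasEigenvalue
    (Matrix.toLin' (M.map (Int.cast : ℤ → ℂ))) μ → ∃ k : ℤ, μ = (k : ℂ)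

/-- A nontrivial symmetric integral matrix with zero diagonal and integral eigenvalues. -/
def IsNontrivialIntegralMatrix (M : Matrix (Fin 3) (Fin 3) ℤ) : Prop :=
  M.IsSymm ∧ (∀ i, M i i = 0) ∧ HasIntegralEigenvalues M ∧
    trivialityPoly (M 0 1) (M 0 2) (M 1 2) ≠ 0

/-- The entries of `M` have no common prime factor. -/
def IsPrimitiveMatrix (M : Matrix (Fin 3) (Fin 3) ℤ) : Prop :=
  ∀ d : ℤ, (∀ i j, d ∣ M i j) → IsUnit d

/-! ### The elliptic curve over `ℚ(t)` and the multiples of the section `P` -/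

/-- Equality in `ℚ(t)` is decided classically (needed for the group law below). -/
instance ratFuncDecidableEq : DecidableEq (RatFunc ℚ) := Classical.decEq _

/-- The parameter `t` of the function field `ℚ(t)`. -/
def tt : RatFunc ℚ := RatFunc.X

/-- The elliptic curve `v² = u (u - 8t(t² - 1)) (u - (t² - 1)(t + 2)²)` over `ℚ(t)`. -/
def genericE : WeierstrassCurve (RatFunc ℚ) where
  a₁ := 0
  a₂ := -(8 * tt * (tt ^ 2 - 1) + (tt ^ 2 - 1) * (tt + 2) ^ 2)
  a₃ := 0
  a₄ := 8 * tt * (tt ^ 2 - 1) * ((tt ^ 2 - 1) * (tt + 2) ^ 2)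
  a₆ := 0

lemma genericE_equation_iff (u v : RatFunc ℚ) :
    genericE.toAffine.Equation u v ↔
      v ^ 2 = u * (u - 8 * tt * (tt ^ 2 - 1)) * (u - (tt ^ 2 - 1) * (tt + 2) ^ 2) := by
  rw [WeierstrassCurve.Affine.equation_iff]
  simp only [genericE]
  constructor <;> intro h <;> linear_combination h

lemma tt_add_C_ne_zero (r : ℚ) : tt + RatFunc.C r ≠ 0 := by
  rw [tt, ← RatFunc.algebraMap_X, ← RatFunc.algebraMap_C, ← map_add]
  exact RatFunc.algebraMap_ne_zero (Polynomial.X_add_C_ne_zero r)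

lemma sectionP_nonsingular :
    genericE.toAffine.Nonsingular (2 * tt ^ 3 * (tt + 1))
      (2 * tt ^ 2 * (tt + 1) ^ 2 * (tt - 2) ^ 2) := by
  rw [WeierstrassCurve.Affine.nonsingular_iff']
  refine ⟨(genericE_equation_iff _ _).2 (by ring), Or.inr ?_⟩
  have h0 : tt ≠ 0 := by simpa using tt_add_C_ne_zero 0
  have h1 : tt + 1 ≠ 0 := by simpa using tt_add_C_ne_zero 1
  have h2 : tt - 2 ≠ 0 := by
    have h := tt_add_C_ne_zero (-2)
    rw [map_neg, ← sub_eq_add_neg] at h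
    have e : (RatFunc.C (2 : ℚ) : RatFunc ℚ) = 2 := map_ofNat _ 2
    rwa [e] at h
  simp only [genericE]
  have h3 : (2 : RatFunc ℚ) ≠ 0 := two_ne_zero
  have : 2 * (2 * tt ^ 2 * (tt + 1) ^ 2 * (tt - 2) ^ 2) ≠ 0 := by positivity
  simpa using this

/-- The point `P = (2t³(t + 1), 2t²(t + 1)²(t - 2)²)`. -/
def sectionP : genericE.toAffine.Point :=
  .some _ _ sectionP_nonsingular

/-- `ν = (x - c) / (a + b)`. -/
def nuOf (p : Fin 6 → RatFunc ℚ) : RatFunc ℚ :=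
  (p 0 - p 5) / (p 3 + p 4)

/-- `λ = (t² - 4) ν + 3t`. -/
def lambdaOf (p : Fin 6 → RatFunc ℚ) : RatFunc ℚ :=
  (tt ^ 2 - 4) * nuOf p + 3 * tt

/-- `μ = t (t² - 4) (z - y) (t ν² - 2 ν + t) / x`. -/
def muOf (p : Fin 6 → RatFunc ℚ) : RatFunc ℚ :=
  tt * (tt ^ 2 - 4) * (p 2 - p 1) * (tt * nuOf p ^ 2 - 2 * nuOf p + tt) / p 0

/-- `u = (μ + (λ² + t (t² - 1) (t + 8))) / 2`. -/
def uOf (p : Fin 6 → RatFunc ℚ) : RatFunc ℚ :=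
  (muOf p + (lambdaOf p ^ 2 + tt * (tt ^ 2 - 1) * (tt + 8))) / 2

/-- `v = (μ λ + λ³ + (t² - 1) (t² - 8) λ - 8 t (t² - 1)²) / 2`. -/
def vOf (p : Fin 6 → RatFunc ℚ) : RatFunc ℚ :=
  (muOf p * lambdaOf p + lambdaOf p ^ 3 + (tt ^ 2 - 1) * (tt ^ 2 - 8) * lambdaOf p
    - 8 * tt * (tt ^ 2 - 1) ^ 2) / 2

/-- The vector `p = (x, y, z, a, b, c)` over `ℚ(t)`, a point of the generic fibre in `P^5`,
corresponds to the point `Q` of the Weierstrass curve under the change of variables `(u, v)`;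
the zero section is the conic `a + b = c - y = 0`. -/
def CorrespondsTo (p : Fin 6 → RatFunc ℚ) : genericE.toAffine.Point → Prop
  | .zero => p 3 + p 4 = 0 ∧ p 5 - p 1 = 0
  | .some u v _ => p 3 + p 4 ≠ 0 ∧ p 0 ≠ 0 ∧ u = uOf p ∧ v = vOf p

/-- The polynomials `p = (x, y, z, a, b, c)` over `ℤ` in one variable `t`, without common factor,
parametrize the section `n P` of the fibration `[x : a] = [2bc : yz]` of `X`: they satisfy the
equations of `X`, the fibre over `t` is given by `x = t a` and `t y z = 2 b c`, and over `ℚ(t)`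
they define the point `n P`. -/
structure ParametrizesMultiple (n : ℤ) (p : Fin 6 → Polynomial ℤ) : Prop where
  primitive : ∀ d : Polynomial ℤ, (∀ i, d ∣ p i) → IsUnit d
  on_surface : SatisfiesSurfaceEquations p
  on_fibre₁ : p 0 = Polynomial.X * p 3
  on_fibre₂ : Polynomial.X * p 1 * p 2 = 2 * p 4 * p 5
  corresponds : CorrespondsTo
    (fun i => algebraMap (Polynomial ℚ) (RatFunc ℚ) ((p i).map (Int.castRingHom ℚ)))
    (n • sectionP)

/-- The integral matrix `M_{a(m), b(m), c(m)}` obtained from `p = (x, y, z, a, b, c)` at the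
integer `m`. -/
def specializedMatrix (p : Fin 6 → Polynomial ℤ) (m : ℤ) : Matrix (Fin 3) (Fin 3) ℤ :=
  symZeroDiag ((p 3).eval m) ((p 4).eval m) ((p 5).eval m)

end

/-! ### The fibre over `t` as a double cover of a conic -/

section FieldAlgebra

/-! For fixed `t`, eliminating `y` and `z` from the fibre equations leaves a conic in `[a : b : c]`
through `[1 : -1 : t]`. Lines through that point give it a parameter `ν`, and `w = z - y` is then a
square root of a quartic in `ν`. On the Weierstrass side, `λ` is the slope of the line joining `(u,
v)` to `R = (4(t² - 1)(t + 1), -4t(t² - 1)²)`, and `μ` is the difference of the abscissas of the two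
intersections other than `R`; `quartic_of_weierstrass` matches the two quartics.

Near `t = 0` the function `t² u` has a nonzero value on `2P`, and each doubling divides that value
by 4, so `P` has infinite order. As `R = ±(P + T)` with `T` of order two, no multiple of `P` is
`±R`, and every nonzero multiple lifts to the fibre.

A value of `ν` fixes a line through `R`, hence comes from finitely many `n`; so a nonzero polynomial
over `ℚ(t)` vanishes at the `ν` of only finitely many `nP` (`finite_multiples_of_eval_nu`). This is
used twice. Applied to the triviality polynomial, it makes almost all sections nontrivial; since `m
a(m)` is an eigenvalue, a given matrix up to scaling arises from finitely many `m`. Applied to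
`G(conicA, conicB, conicC)`, it shows that a form `G(a, b, c)` vanishing at all rational points
vanishes on the whole conic family, which covers all positive real `(a, b, c)`, so `G = 0`.

Density follows because the coordinate ring of `X` is an integral domain, free over `ℚ[a, b, c]` on
`xⁱ yʲ` (`i < 3`, `j < 2`): a form `F` not vanishing on `X` divides a nonzero `G(a, b, c)` there
(`exists_eliminant`), and a rational point with `G ≠ 0` has `F ≠ 0`. -/

/-- The quadratic form `t ν² - 2 ν + t`. -/
def conicA {R : Type*} [CommRing R] (t ν : R) : R := t * ν ^ 2 - 2 * ν + t

/-- The second off-diagonal entry of the matrix attached to `(t, ν)`. -/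
def conicB {R : Type*} [CommRing R] (t ν : R) : R := -(t * (1 - 2 * t * ν + ν ^ 2))

/-- The third off-diagonal entry of the matrix attached to `(t, ν)`. -/
def conicC {R : Type*} [CommRing R] (t ν : R) : R :=
  t * (t * ν ^ 2 - 2 * ν + t) - 2 * ν ^ 2 * (t ^ 2 - 1)

section Map

variable {R S : Type*} [CommRing R] [CommRing S] (f : R →+* S) (t ν : R)

lemma map_conicA : f (conicA t ν) = conicA (f t) (f ν) := by
  simp only [conicA, map_add, map_sub, map_mul, map_pow, map_ofNat]

lemma map_conicB : f (conicB t ν) = conicB (f t) (f ν) := by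
  simp only [conicB, map_neg, map_add, map_sub, map_mul, map_pow, map_ofNat, map_one]

lemma map_conicC : f (conicC t ν) = conicC (f t) (f ν) := by
  simp only [conicC, map_add, map_sub, map_mul, map_pow, map_ofNat, map_one]

lemma map_trivialityPoly (a b c : R) :
    f (trivialityPoly a b c) = trivialityPoly (f a) (f b) (f c) := by
  simp only [trivialityPoly, map_sub, map_mul, map_pow]

end Map

variable {F : Type*} [Field F]

/-- On the line of parameter `ν` through `[1 : -1 : t]` the equation of the conic acquires the
factor `a + b`; cancelling it leaves a linear equation for the second intersection. -/
lemma conic_of_fibre {t a b c ν : F} (h : t * ((t * a) ^ 2 - a ^ 2 - b ^ 2 - c ^ 2) = 2 * b * c)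
    (hν : ν * (a + b) = t * a - c) (hab : a + b ≠ 0) :
    b * conicA t ν = conicB t ν * a ∧ c * conicA t ν = conicC t ν * a := by
  have hc : c = t * a - ν * (a + b) := by linear_combination hν
  subst hc
  have hb : b * conicA t ν = conicB t ν * a := by
    apply mul_left_cancel₀ hab
    unfold conicA conicB
    linear_combination -h
  refine ⟨hb, ?_⟩
  unfold conicA conicB conicC at *
  linear_combination -ν * hb

/-- The vector `(x, y, z, a, b, c)` attached to the coordinates `ν` and `w` on the fibre. -/
def fibreVector (t ν w : F) : Fin 6 → F :=
  ![t * conicA t ν, (-(t * conicA t ν) - w) / 2, (-(t * conicA t ν) + w) / 2,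
    conicA t ν, conicB t ν, conicC t ν]

lemma fibreVector_fibre [NeZero (2 : F)] {t ν w : F}
    (hw : t * (t ^ 2 * conicA t ν ^ 2 - w ^ 2) = 8 * conicB t ν * conicC t ν) :
    t * ((-(t * conicA t ν) - w) / 2) * ((-(t * conicA t ν) + w) / 2) =
      2 * conicB t ν * conicC t ν := by
  have h2 : (2 : F) ≠ 0 := NeZero.ne 2
  field_simp
  linear_combination hw

lemma fibreVector_satisfies [NeZero (2 : F)] {t ν w : F} (ht : t ≠ 0)
    (hw : t * (t ^ 2 * conicA t ν ^ 2 - w ^ 2) = 8 * conicB t ν * conicC t ν) :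
    SatisfiesSurfaceEquations (fibreVector t ν w) := by
  have h2 : (2 : F) ≠ 0 := NeZero.ne 2
  have h := fibreVector_fibre hw
  have hsum : t * conicA t ν + (-(t * conicA t ν) - w) / 2 + (-(t * conicA t ν) + w) / 2 = 0 := by
    field_simp
    ring
  refine ⟨hsum, ?_, ?_⟩
  · apply mul_left_cancel₀ ht
    -- The parametrized point lies on the conic identically in `t` and `ν`; `hw` only governs `y`
    -- and `z`.
    have key : t * ((t * conicA t ν) ^ 2 - conicA t ν ^ 2 - conicB t ν ^ 2 - conicC t ν ^ 2)
        = 2 * conicB t ν * conicC t ν := by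
      unfold conicA conicB conicC
      ring
    simp only [fibreVector]
    simp only [Matrix.cons_val]
    linear_combination h - key + t * (t * conicA t ν) * hsum
  · simp only [fibreVector]
    simp only [Matrix.cons_val]
    linear_combination conicA t ν * h

/-- Here `l` is the slope of the line through `(u, v)` and `R`. The abscissas other than that of `R`
sum to `l² + t(t² - 1)(t + 8)`, so `(t² - 4)w` is their difference, and its square is the
discriminant of the residual quadratic. -/
lemma quartic_of_weierstrass {t u v l ν w : F}
    (hE : v ^ 2 = u * (u - 8 * t * (t ^ 2 - 1)) * (u - (t ^ 2 - 1) * (t + 2) ^ 2))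
    (hu : u - 4 * (t ^ 2 - 1) * (t + 1) ≠ 0) (ht : t ^ 2 - 4 ≠ 0)
    (hl : l * (u - 4 * (t ^ 2 - 1) * (t + 1)) = v + 4 * t * (t ^ 2 - 1) ^ 2)
    (hν : l = (t ^ 2 - 4) * ν + 3 * t)
    (hw : (t ^ 2 - 4) * w = 2 * u - l ^ 2 - t * (t ^ 2 - 1) * (t + 8)) :
    t * (t ^ 2 * conicA t ν ^ 2 - w ^ 2) = 8 * conicB t ν * conicC t ν := by
  have hv : v = l * (u - 4 * (t ^ 2 - 1) * (t + 1)) - 4 * t * (t ^ 2 - 1) ^ 2 := by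
    linear_combination -hl
  subst hv hν
  rw [← sub_eq_zero]
  refine (mul_eq_zero.1 ((?_ : (u - 4 * (t ^ 2 - 1) * (t + 1)) * (t ^ 2 - 4) ^ 2 *
      (t * (t ^ 2 * conicA t ν ^ 2 - w ^ 2) - 8 * conicB t ν * conicC t ν) = 0))).resolve_left
    (mul_ne_zero hu (pow_ne_zero 2 ht))
  unfold conicA conicB conicC
  linear_combination -(u - 4 * (t ^ 2 - 1) * (t + 1)) * t * ((t ^ 2 - 4) * w +
    (2 * u - ((t ^ 2 - 4) * ν + 3 * t) ^ 2 - t * (t ^ 2 - 1) * (t + 8))) * hw + 4 * t * hE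

end FieldAlgebra

/-! ### Nonvanishing and non-squares in `ℚ(t)` -/

section RationalFunctions

open Polynomial

/-- The embedding of polynomials into `ℚ(t)`. -/
noncomputable abbrev ofPoly : ℚ[X] →+* RatFunc ℚ := algebraMap ℚ[X] (RatFunc ℚ)

lemma ofPoly_injective : Function.Injective ofPoly := RatFunc.algebraMap_injective ℚ

lemma ofPoly_X : ofPoly X = tt := RatFunc.algebraMap_X

lemma ofPoly_ne_zero_of_eval {f : ℚ[X]} {r : ℚ} (h : f.eval r ≠ 0) : ofPoly f ≠ 0 := by
  intro h0
  have : f = 0 := ofPoly_injective (by simpa using h0)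
  simp [this] at h

/-- `ℚ[X]` is integrally closed, so a square root of `f` would be a polynomial and could be
evaluated at `r`. -/
lemma sq_ne_ofPoly_of_eval {f : ℚ[X]} (r : ℚ) (h : ¬ IsSquare (f.eval r)) (g : RatFunc ℚ) :
    g ^ 2 ≠ ofPoly f := by
  intro hg
  obtain ⟨s, rfl⟩ := IsIntegrallyClosed.exists_algebraMap_eq_of_isIntegral_pow
    (R := ℚ[X]) (K := RatFunc ℚ) (x := g) (n := 2) two_pos
    (by rw [hg]; exact isIntegral_algebraMap)
  have : s ^ 2 = f := ofPoly_injective (by rw [map_pow]; exact hg)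
  exact h ⟨s.eval r, by rw [← this, eval_pow, sq]⟩

lemma tt_ne_zero : tt ≠ 0 := by
  rw [← ofPoly_X]; exact ofPoly_ne_zero_of_eval (r := 1) (by simp)

lemma tt_sq_sub_four_ne_zero : tt ^ 2 - 4 ≠ 0 := by
  have : ofPoly (X ^ 2 - 4) ≠ 0 := ofPoly_ne_zero_of_eval (r := 0) (by simp)
  simpa only [map_sub, map_pow, map_one, map_ofNat, ofPoly_X] using this

lemma tt_sq_sub_one_ne_zero : tt ^ 2 - 1 ≠ 0 := by
  have : ofPoly (X ^ 2 - 1) ≠ 0 := ofPoly_ne_zero_of_eval (r := 0) (by simp)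
  simpa only [map_sub, map_pow, map_one, map_ofNat, ofPoly_X] using this

lemma sq_ne_tt_sq_add_eight (g : RatFunc ℚ) : g ^ 2 ≠ tt ^ 2 + 8 := by
  have : ¬ IsSquare (((X : ℚ[X]) ^ 2 + 8).eval 0) := by
    simp only [eval_add, eval_pow, eval_X, eval_ofNat]
    rw [Rat.isSquare_iff]
    norm_num
  simpa only [map_add, map_pow, map_ofNat, ofPoly_X] using sq_ne_ofPoly_of_eval 0 this g

/-- A zero would give `(tν - 1)² = 1 - t²`, which is negative at `t = 2`. -/
lemma conicA_tt_ne_zero (ν : RatFunc ℚ) : conicA tt ν ≠ 0 := by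
  intro h
  have h1 : ¬ IsSquare ((1 - (X : ℚ[X]) ^ 2).eval 2) := by
    simp only [eval_sub, eval_one, eval_pow, eval_X]
    intro h
    have := h.nonneg
    norm_num at this
  have h2 := sq_ne_ofPoly_of_eval 2 h1 (tt * ν - 1)
  apply h2
  simp only [map_sub, map_one, map_pow, ofPoly_X]
  unfold conicA at h
  linear_combination tt * h

end RationalFunctions

/-! ### Infinite order of `P`, from its behaviour at `t = 0` -/

section InfiniteOrder

open Polynomial WeierstrassCurve.Affine

lemma genericE_double {u v : RatFunc ℚ} (h : genericE.toAffine.Nonsingular u v) (hv : v ≠ 0) :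
    ∃ (u' v' : RatFunc ℚ) (h' : genericE.toAffine.Nonsingular u' v'),
      u' * (2 * v) ^ 2 =
        (u ^ 2 - 8 * tt * (tt ^ 2 - 1) * ((tt ^ 2 - 1) * (tt + 2) ^ 2)) ^ 2 ∧
      Point.some u v h + Point.some u v h = Point.some u' v' h' := by
  have hy : v ≠ genericE.toAffine.negY u v := by
    simp only [negY, genericE]
    intro h1
    apply hv
    linear_combination h1 / 2
  refine ⟨_, _, _, ?_, Point.add_self_of_Y_ne hy⟩
  have hE := (genericE_equation_iff u v).1 h.1
  rw [slope_of_Y_ne rfl hy]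
  simp only [addX, negY, genericE]
  have h2 : v - (-v - 0 * u - 0) = 2 * v := by ring
  have h3 : 2 * v ≠ 0 := mul_ne_zero two_ne_zero hv
  rw [h2]
  field_simp
  linear_combination (-(4 * (2 * u - (8 * tt * (tt ^ 2 - 1) + (tt ^ 2 - 1) * (tt + 2) ^ 2)))) * hE

/-- The function `t² u` takes the value `α` at `t = 0` on the point `Q = (u, v)`. -/
def LeadsAtZero (Q : genericE.toAffine.Point) (α : ℚ) : Prop :=
  ∃ (u v : RatFunc ℚ) (h : genericE.toAffine.Nonsingular u v) (N D : ℚ[X]),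
    Q = .some u v h ∧ N.eval 0 ≠ 0 ∧ D.eval 0 ≠ 0 ∧ N.eval 0 = α * D.eval 0 ∧
      u * (tt ^ 2 * ofPoly D) = ofPoly N

lemma LeadsAtZero.unique {Q : genericE.toAffine.Point} {α β : ℚ} (h₁ : LeadsAtZero Q α)
    (h₂ : LeadsAtZero Q β) : α = β := by
  obtain ⟨u, v, h, N, D, rfl, hN, hD, hα, hu⟩ := h₁
  obtain ⟨u', v', h', N', D', hQ, hN', hD', hβ, hu'⟩ := h₂
  obtain ⟨rfl, rfl⟩ := Point.some.inj hQ
  have : N * D' = N' * D := by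
    apply ofPoly_injective
    rw [map_mul, map_mul, ← hu, ← hu']
    ring
  have := congrArg (eval 0) this
  rw [eval_mul, eval_mul, hα, hβ] at this
  have h3 : (α - β) * (D.eval 0 * D'.eval 0) = 0 := by linear_combination this
  simpa [hD, hD', sub_eq_zero] using h3

/-- Where `u` has a double pole, the duplication formula is dominated by `u⁴ / (4u³) = u / 4`. -/
lemma LeadsAtZero.double {Q : genericE.toAffine.Point} {α : ℚ} (h : LeadsAtZero Q α) :
    LeadsAtZero (Q + Q) (α / 4) := by
  obtain ⟨u, v, h, N, D, rfl, hN, hD, hα, hu⟩ := h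
  have hE := (genericE_equation_iff u v).1 h.1
  -- Both sides of the duplication formula are cleared of denominators by the factor `t⁸ D⁴`.
  set N' : ℚ[X] := (N ^ 2 - 8 * X * (X ^ 2 - 1) * ((X ^ 2 - 1) * (X + 2) ^ 2) * X ^ 4 * D ^ 2) ^ 2
    with hN'
  set D' : ℚ[X] := 4 * D * N * (N - 8 * X * (X ^ 2 - 1) * X ^ 2 * D) *
    (N - (X ^ 2 - 1) * (X + 2) ^ 2 * X ^ 2 * D) with hD'
  have hN0 : N'.eval 0 = N.eval 0 ^ 4 := by simp [hN']; ring
  have hD0 : D'.eval 0 = 4 * D.eval 0 * N.eval 0 ^ 3 := by simp [hD']; ring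
  have hDne : D'.eval 0 ≠ 0 := by rw [hD0]; positivity
  have hd : tt ^ 2 * ofPoly D ≠ 0 :=
    mul_ne_zero (pow_ne_zero 2 tt_ne_zero) (ofPoly_ne_zero_of_eval hD)
  have hDK : ofPoly D' = 4 * tt ^ 6 * ofPoly D ^ 4 * v ^ 2 := by
    rw [hE, hD']
    simp only [map_mul, map_sub, map_add, map_pow, map_one, map_ofNat, ofPoly_X]
    rw [← hu]
    ring
  have hv : v ≠ 0 := by
    rintro rfl
    apply ofPoly_ne_zero_of_eval hDne
    rw [hDK]
    ring
  obtain ⟨u', v', h', hu', e⟩ := genericE_double h hv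
  refine ⟨u', v', h', N', D', e, by rw [hN0]; positivity, hDne, ?_, ?_⟩
  · rw [hN0, hD0, hα]
    ring
  · rw [hDK, hN']
    simp only [map_mul, map_sub, map_add, map_pow, map_one, map_ofNat, ofPoly_X]
    rw [← hu]
    linear_combination tt ^ 8 * ofPoly D ^ 4 * hu'

/-- At `t = 0` the curve becomes `v² = u²(u + 4)` and `P` passes through its node, so the estimate
can only start at `2P`. -/
lemma leadsAtZero_double_sectionP : LeadsAtZero (sectionP + sectionP) 4 := by
  have hv : 2 * tt ^ 2 * (tt + 1) ^ 2 * (tt - 2) ^ 2 ≠ 0 := by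
    have : ofPoly (2 * X ^ 2 * (X + 1) ^ 2 * (X - 2) ^ 2) ≠ 0 :=
      ofPoly_ne_zero_of_eval (r := 1) (by norm_num)
    simpa only [map_mul, map_sub, map_add, map_pow, map_one, map_ofNat, ofPoly_X] using this
  obtain ⟨u', v', h', hu', e⟩ := genericE_double sectionP_nonsingular hv
  -- The duplication formula for `P` after cancelling `16t²(t + 1)⁴`; the values at 0 are 64 and 16.
  refine ⟨u', v', h', (X ^ 5 - 2 * (X - 1) ^ 2 * (X + 2) ^ 2) ^ 2, (X - 2) ^ 4, e, ?_, ?_, ?_, ?_⟩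
  · norm_num
  · norm_num
  · norm_num
  · have hc : 16 * tt ^ 4 * (tt + 1) ^ 4 * (tt - 2) ^ 4 ≠ 0 := by
      convert pow_ne_zero 2 (mul_ne_zero two_ne_zero hv) using 1
      ring
    simp only [map_mul, map_sub, map_add, map_pow, map_one, map_ofNat, ofPoly_X]
    apply mul_left_cancel₀ hc
    linear_combination tt ^ 2 * (tt - 2) ^ 4 * hu'

lemma leadsAtZero_two_pow (k : ℕ) : LeadsAtZero (2 ^ (k + 1) • sectionP) (4 / 4 ^ k) := by
  induction k with
  | zero => simpa [two_nsmul] using leadsAtZero_double_sectionP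
  | succ k ih =>
    have := ih.double
    rw [← two_nsmul, ← mul_nsmul', ← pow_succ'] at this
    convert this using 1
    rw [pow_succ]
    ring

/-- A torsion point has finitely many multiples, while the points `2ᵏ⁺¹ P` have distinct leading
values `4 / 4ᵏ`. -/
lemma injective_zsmul_sectionP : Function.Injective (fun n : ℤ => n • sectionP) := by
  rw [injective_zsmul_iff_not_isOfFinAddOrder]
  intro h
  have hfin : (Set.range fun n : ℕ => n • sectionP).Finite := by
    have := h.finite_multiples
    convert this using 1
    ext Q
    simp [AddSubmonoid.mem_multiples_iff]
  have hinj : Function.Injective fun k : ℕ => (2 ^ (k + 1)) • sectionP := by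
    intro j k hjk
    have h1 := leadsAtZero_two_pow j
    simp only at hjk
    rw [hjk] at h1
    have h2 := h1.unique (leadsAtZero_two_pow k)
    have h3 : (4 : ℚ) ^ j = 4 ^ k := by
      rw [div_eq_div_iff (by positivity) (by positivity)] at h2
      linarith
    exact pow_right_injective₀ (by norm_num) (by norm_num) h3
  refine Set.infinite_range_of_injective hinj (hfin.subset ?_)
  rintro _ ⟨k, rfl⟩
  exact ⟨_, rfl⟩

end InfiniteOrder

/-! ### Lifting the multiples of `P` to polynomial points of the fibre -/

section SectionMultiples

open Polynomial WeierstrassCurve.Affine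

lemma twoTorsion_nonsingular : genericE.toAffine.Nonsingular (8 * tt * (tt ^ 2 - 1)) 0 := by
  rw [WeierstrassCurve.Affine.nonsingular_iff']
  refine ⟨(genericE_equation_iff _ _).2 (by ring), Or.inl ?_⟩
  simp only [genericE]
  have : ofPoly (8 * X * (X ^ 2 - 1) ^ 2 * (X - 2) ^ 2) ≠ 0 :=
    ofPoly_ne_zero_of_eval (r := 3) (by norm_num)
  simp only [map_mul, map_sub, map_pow, map_one, map_ofNat, ofPoly_X] at this
  intro h
  apply this
  linear_combination h

/-- The point `(8 t (t² - 1), 0)` of order two. -/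
noncomputable def twoTorsion : genericE.toAffine.Point := .some _ _ twoTorsion_nonsingular

lemma twoTorsion_add_self : twoTorsion + twoTorsion = 0 :=
  Point.add_self_of_Y_eq (by simp [negY, genericE])

/-- This identifies the abscissa of `R`, where the slope formula for `λ` breaks down. -/
lemma sectionP_add_twoTorsion :
    ∃ (v : RatFunc ℚ) (h : genericE.toAffine.Nonsingular (4 * (tt ^ 2 - 1) * (tt + 1)) v),
      sectionP + twoTorsion = .some _ v h := by
  have h1 : ofPoly (2 * X * (X + 1) * (X - 2) ^ 2) ≠ 0 :=
    ofPoly_ne_zero_of_eval (r := 1) (by norm_num)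
  simp only [map_mul, map_sub, map_add, map_pow, map_one, map_ofNat, ofPoly_X] at h1
  have e1 : 2 * tt ^ 3 * (tt + 1) - 8 * tt * (tt ^ 2 - 1) = 2 * tt * (tt + 1) * (tt - 2) ^ 2 := by
    ring
  have hne : 2 * tt ^ 3 * (tt + 1) ≠ 8 * tt * (tt ^ 2 - 1) := by
    rw [← sub_ne_zero, e1]
    exact h1
  have hs : genericE.toAffine.slope (2 * tt ^ 3 * (tt + 1)) (8 * tt * (tt ^ 2 - 1))
      (2 * tt ^ 2 * (tt + 1) ^ 2 * (tt - 2) ^ 2) 0 = tt * (tt + 1) := by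
    rw [slope_of_X_ne hne, e1, div_eq_iff h1]
    ring
  have hx : genericE.toAffine.addX (2 * tt ^ 3 * (tt + 1)) (8 * tt * (tt ^ 2 - 1))
      (tt * (tt + 1)) = 4 * (tt ^ 2 - 1) * (tt + 1) := by
    simp only [addX, genericE]
    ring
  have hsum : ∃ (u v : RatFunc ℚ) (h : genericE.toAffine.Nonsingular u v),
      u = 4 * (tt ^ 2 - 1) * (tt + 1) ∧ sectionP + twoTorsion = .some u v h :=
    ⟨_, _, _, by rw [hs, hx], Point.add_of_X_ne hne⟩
  obtain ⟨u, v, h, rfl, e⟩ := hsum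
  exact ⟨v, h, e⟩

/-- Otherwise `nP = ±(P + T)`, so `(n ∓ 1)P = T` has order two, against the infinite order of `P`.
-/
lemma zsmul_sectionP_x_ne {n : ℤ} {u v : RatFunc ℚ} {h : genericE.toAffine.Nonsingular u v}
    (hn : n • sectionP = .some u v h) : u - 4 * (tt ^ 2 - 1) * (tt + 1) ≠ 0 := by
  intro hu
  obtain ⟨v', h', e⟩ := sectionP_add_twoTorsion
  have hT : twoTorsion ≠ 0 := Point.some_ne_zero _
  have hinj := injective_zsmul_sectionP
  have h2T := twoTorsion_add_self
  have key : ∀ k : ℤ, k • sectionP = twoTorsion → False := by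
    intro k hk
    have h0 : (k + k) • sectionP = (0 : ℤ) • sectionP := by
      rw [add_zsmul, hk, h2T, zero_zsmul]
    have : k = 0 := by have := hinj h0; omega
    rw [this, zero_zsmul] at hk
    exact hT hk.symm
  rcases Point.X_eq_iff.1 (sub_eq_zero.1 hu) with h1 | h1
  · apply key (n - 1)
    rw [sub_zsmul, one_zsmul, hn, h1, ← e]
    abel
  · apply key (n + 1)
    have h3 : -twoTorsion = twoTorsion := by rw [neg_eq_iff_add_eq_zero, h2T]
    rw [add_zsmul, one_zsmul, hn, h1, ← e, neg_add, h3]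
    abel

lemma SatisfiesSurfaceEquations.smul {R : Type*} [CommRing R] {p : Fin 6 → R}
    (h : SatisfiesSurfaceEquations p) (c : R) :
    SatisfiesSurfaceEquations fun i => c * p i := by
  obtain ⟨h1, h2, h3⟩ := h
  exact ⟨by linear_combination c * h1, by linear_combination c ^ 2 * h2,
    by linear_combination c ^ 3 * h3⟩

lemma SatisfiesSurfaceEquations.map {R S : Type*} [CommRing R] [CommRing S] {p : Fin 6 → R}
    (h : SatisfiesSurfaceEquations p) (f : R →+* S) :
    SatisfiesSurfaceEquations fun i => f (p i) := by
  obtain ⟨h1, h2, h3⟩ := h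
  refine ⟨?_, ?_, ?_⟩
  · simpa using congrArg f h1
  · simpa using congrArg f h2
  · simpa only [map_mul, map_ofNat] using congrArg f h3

lemma SatisfiesSurfaceEquations.of_map {R S : Type*} [CommRing R] [CommRing S] {p : Fin 6 → R}
    {f : R →+* S} (hf : Function.Injective f)
    (h : SatisfiesSurfaceEquations fun i => f (p i)) : SatisfiesSurfaceEquations p := by
  obtain ⟨h1, h2, h3⟩ := h
  exact ⟨hf (by simpa using h1), hf (by simpa using h2),
    hf (by simpa only [map_mul, map_ofNat] using h3)⟩

lemma CorrespondsTo.smul {p : Fin 6 → RatFunc ℚ} {Q : genericE.toAffine.Point}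
    (h : CorrespondsTo p Q) {c : RatFunc ℚ} (hc : c ≠ 0) :
    CorrespondsTo (fun i => c * p i) Q := by
  cases Q with
  | zero =>
    obtain ⟨h1, h2⟩ := h
    exact ⟨by linear_combination c * h1, by linear_combination c * h2⟩
  | some u v hQ =>
    obtain ⟨h1, h2, h3, h4⟩ := h
    have hν : nuOf (fun i => c * p i) = nuOf p := by
      unfold nuOf
      rw [← mul_sub, ← mul_add, mul_div_mul_left _ _ hc]
    have hl : lambdaOf (fun i => c * p i) = lambdaOf p := by
      unfold lambdaOf
      rw [hν]
    have hm : muOf (fun i => c * p i) = muOf p := by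
      unfold muOf
      rw [hν]
      field_simp
    refine ⟨?_, mul_ne_zero hc h2, ?_, ?_⟩
    · rw [← mul_add]
      exact mul_ne_zero hc h1
    · unfold uOf
      rw [hm, hl]
      exact h3
    · unfold vOf
      rw [hm, hl]
      exact h4

lemma conicA_add_conicB {F : Type*} [Field F] (t ν : F) :
    conicA t ν + conicB t ν = 2 * ν * (t ^ 2 - 1) := by
  unfold conicA conicB
  ring

lemma exists_fibreVector {u v : RatFunc ℚ} (h : genericE.toAffine.Nonsingular u v)
    (hu : u - 4 * (tt ^ 2 - 1) * (tt + 1) ≠ 0) :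
    ∃ ν w : RatFunc ℚ, tt * (tt ^ 2 * conicA tt ν ^ 2 - w ^ 2) = 8 * conicB tt ν * conicC tt ν ∧
      CorrespondsTo (fibreVector tt ν w) (.some u v h) := by
  have ht4 := tt_sq_sub_four_ne_zero
  set l := (v + 4 * tt * (tt ^ 2 - 1) ^ 2) / (u - 4 * (tt ^ 2 - 1) * (tt + 1)) with hl
  have hl' : l * (u - 4 * (tt ^ 2 - 1) * (tt + 1)) = v + 4 * tt * (tt ^ 2 - 1) ^ 2 :=
    div_mul_cancel₀ _ hu
  set ν := (l - 3 * tt) / (tt ^ 2 - 4) with hν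
  have hν' : (tt ^ 2 - 4) * ν = l - 3 * tt := mul_div_cancel₀ _ ht4
  set w := (2 * u - l ^ 2 - tt * (tt ^ 2 - 1) * (tt + 8)) / (tt ^ 2 - 4) with hw
  have hw' : (tt ^ 2 - 4) * w = 2 * u - l ^ 2 - tt * (tt ^ 2 - 1) * (tt + 8) :=
    mul_div_cancel₀ _ ht4
  have hq := quartic_of_weierstrass ((genericE_equation_iff u v).1 h.1) hu ht4 hl'
    (by rw [hν']; ring) hw'
  refine ⟨ν, w, hq, ?_⟩
  -- At `ν = 0` the quartic relation reads `(w / t)² = t² + 8`. Nonvanishing of `ν` is what makes `a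
  -- + b ≠ 0`.
  have hν0 : ν ≠ 0 := by
    intro h0
    rw [h0] at hq
    simp only [conicA, conicB, conicC] at hq
    apply sq_ne_tt_sq_add_eight (w / tt)
    rw [div_pow, div_eq_iff (pow_ne_zero 2 tt_ne_zero)]
    apply mul_left_cancel₀ tt_ne_zero
    linear_combination -hq
  have hA := conicA_tt_ne_zero ν
  have hab : conicA tt ν + conicB tt ν ≠ 0 := by
    rw [conicA_add_conicB]
    exact mul_ne_zero (mul_ne_zero two_ne_zero hν0) tt_sq_sub_one_ne_zero
  have hnu : nuOf (fibreVector tt ν w) = ν := by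
    simp only [nuOf, fibreVector, Matrix.cons_val]
    rw [div_eq_iff hab]
    unfold conicA conicB conicC
    ring
  have hlam : lambdaOf (fibreVector tt ν w) = l := by
    rw [lambdaOf, hnu, hν']
    ring
  have hmu : muOf (fibreVector tt ν w) = 2 * u - l ^ 2 - tt * (tt ^ 2 - 1) * (tt + 8) := by
    rw [muOf, hnu, ← hw']
    simp only [fibreVector, Matrix.cons_val]
    have ht := tt_ne_zero
    have : tt * ν ^ 2 - 2 * ν + tt = conicA tt ν := rfl
    rw [this]
    field_simp
    ring
  refine ⟨hab, mul_ne_zero tt_ne_zero hA, ?_, ?_⟩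
  · rw [uOf, hmu, hlam]
    ring
  · rw [vOf, hmu, hlam]
    linear_combination -hl'

/-- The embedding of integral polynomials into `ℚ(t)`. -/
noncomputable abbrev ofIntPoly : ℤ[X] →+* RatFunc ℚ :=
  ofPoly.comp (mapRingHom (Int.castRingHom ℚ))

lemma ofIntPoly_injective : Function.Injective ofIntPoly :=
  ofPoly_injective.comp (map_injective _ Int.cast_injective)

lemma ofIntPoly_X : ofIntPoly X = tt := by
  rw [RingHom.comp_apply, coe_mapRingHom, map_X, ofPoly_X]

lemma exists_ofIntPoly_mul_eq_of_poly (f : ℚ[X]) :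
    ∃ a b : ℤ[X], b ≠ 0 ∧ ofIntPoly b * ofPoly f = ofIntPoly a := by
  obtain ⟨b, hb0, hb⟩ := IsLocalization.integerNormalization_spec (nonZeroDivisors ℤ) f
  refine ⟨IsLocalization.integerNormalization (nonZeroDivisors ℤ) f, C b, ?_, ?_⟩
  · simpa using nonZeroDivisors.ne_zero hb0
  · have : mapRingHom (Int.castRingHom ℚ)
        (IsLocalization.integerNormalization (nonZeroDivisors ℤ) f) = C (b : ℚ) * f := by
      rw [← smul_eq_C_mul, Int.cast_smul_eq_zsmul, ← hb]
      rfl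
    rw [RingHom.comp_apply, RingHom.comp_apply, this, map_mul]
    simp

lemma exists_ofIntPoly_mul_eq (f : RatFunc ℚ) :
    ∃ a b : ℤ[X], b ≠ 0 ∧ ofIntPoly b * f = ofIntPoly a := by
  obtain ⟨a, b, hb, hab⟩ := exists_ofIntPoly_mul_eq_of_poly f.num
  obtain ⟨a', b', hb', hab'⟩ := exists_ofIntPoly_mul_eq_of_poly f.denom
  have hd : ofPoly f.denom ≠ 0 := RatFunc.algebraMap_ne_zero f.denom_ne_zero
  have hf : f * ofPoly f.denom = ofPoly f.num := by
    rw [← eq_div_iff hd, RatFunc.num_div_denom]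
  refine ⟨a * b', b * a', ?_, ?_⟩
  · refine mul_ne_zero hb ?_
    rintro rfl
    rw [map_zero, mul_eq_zero] at hab'
    rcases hab' with h | h
    · exact hb' (ofIntPoly_injective (by simpa using h))
    · exact hd h
  · rw [map_mul, map_mul, ← hab, ← hab', ← hf]
    ring

/-- Clear denominators, then divide by the gcd, which exists because `ℤ[X]` is factorial. -/
lemma exists_primitive_multiple {v : Fin 6 → RatFunc ℚ} (hv : v ≠ 0) :
    ∃ (c : RatFunc ℚ) (p : Fin 6 → ℤ[X]), c ≠ 0 ∧ (∀ i, ofIntPoly (p i) = c * v i) ∧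
      ∀ d : ℤ[X], (∀ i, d ∣ p i) → IsUnit d := by
  choose a b hb hab using fun i => exists_ofIntPoly_mul_eq (v i)
  set p' : Fin 6 → ℤ[X] := fun i => a i * ∏ j ∈ Finset.univ.erase i, b j with hp'
  set B := ∏ j, b j with hB
  have hB0 : ofIntPoly B ≠ 0 := by
    rw [Ne, map_eq_zero_iff _ ofIntPoly_injective]
    exact Finset.prod_ne_zero_iff.2 fun i _ => hb i
  have hp : ∀ i, ofIntPoly (p' i) = ofIntPoly B * v i := by
    intro i
    rw [hp', hB, ← Finset.mul_prod_erase _ _ (Finset.mem_univ i), map_mul, map_mul, ← hab i]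
    ring
  let _ : NormalizedGCDMonoid ℤ[X] := UniqueFactorizationMonoid.toNormalizedGCDMonoid _
  obtain ⟨g, hg, hg1⟩ := Finset.extract_gcd p' (Finset.univ_nonempty (α := Fin 6))
  set G := Finset.univ.gcd p' with hG
  have hG0 : ofIntPoly G ≠ 0 := by
    intro h0
    apply hv
    funext i
    have := hp i
    rw [hg i (Finset.mem_univ i), map_mul, h0, zero_mul] at this
    exact (mul_eq_zero.1 this.symm).resolve_left hB0
  refine ⟨ofIntPoly B / ofIntPoly G, g, div_ne_zero hB0 hG0, ?_, ?_⟩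
  · intro i
    have := hp i
    rw [hg i (Finset.mem_univ i), map_mul] at this
    field_simp
    linear_combination this
  · intro d hd
    rw [isUnit_iff_dvd_one, ← hg1]
    exact Finset.dvd_gcd fun i _ => hd i

lemma parametrizesMultiple_of_vector {n : ℤ} {v : Fin 6 → RatFunc ℚ} (hv : v ≠ 0)
    (h : SatisfiesSurfaceEquations v) (h₁ : v 0 = tt * v 3) (h₂ : tt * v 1 * v 2 = 2 * v 4 * v 5)
    (hc : CorrespondsTo v (n • sectionP)) :
    ∃ p : Fin 6 → ℤ[X], ParametrizesMultiple n p := by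
  obtain ⟨c, p, hc0, hp, hprim⟩ := exists_primitive_multiple hv
  refine ⟨p, hprim, ?_, ?_, ?_, ?_⟩
  · apply SatisfiesSurfaceEquations.of_map ofIntPoly_injective
    simp only [hp]
    exact h.smul c
  · apply ofIntPoly_injective
    rw [map_mul, ofIntPoly_X, hp, hp, h₁]
    ring
  · apply ofIntPoly_injective
    rw [map_mul, map_mul, map_mul, map_mul, ofIntPoly_X, hp, hp, hp, hp, map_ofNat]
    linear_combination c ^ 2 * h₂
  · have := hc.smul hc0
    simp only [← hp] at this
    exact this

lemma exists_parametrizesMultiple (n : ℤ) : ∃ p : Fin 6 → ℤ[X], ParametrizesMultiple n p := by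
  rcases hn : n • sectionP with _ | ⟨u, v, h⟩
  · have ht := tt_ne_zero
    -- The zero section, found from `b = -a`, `c = y`: then `tyz = 2bc` with `a = t` gives `z = -2`,
    -- and `y = 2 - t²`.
    refine parametrizesMultiple_of_vector
      (v := ![tt ^ 2, 2 - tt ^ 2, -2, tt, -tt, 2 - tt ^ 2]) ?_ ?_ ?_ ?_ ?_
    · intro h
      exact ht (by simpa using congrFun h 3)
    · refine ⟨?_, ?_, ?_⟩ <;> simp only [Matrix.cons_val] <;> ring
    · simp only [Matrix.cons_val]
      ring
    · simp only [Matrix.cons_val]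
      ring
    · rw [hn]
      refine ⟨?_, ?_⟩ <;> simp only [Matrix.cons_val] <;> ring
  · obtain ⟨ν, w, hw, hc⟩ := exists_fibreVector h (zsmul_sectionP_x_ne hn)
    refine parametrizesMultiple_of_vector (v := fibreVector tt ν w) ?_
      (fibreVector_satisfies tt_ne_zero hw) ?_ ?_ (by rw [hn]; exact hc)
    · intro h0
      exact conicA_tt_ne_zero ν (by simpa [fibreVector] using congrFun h0 3)
    · simp only [fibreVector, Matrix.cons_val]
    · simpa only [fibreVector, Matrix.cons_val] using fibreVector_fibre hw

end SectionMultiples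

/-! ### Each value of `ν` occurs for finitely many multiples -/

section Finiteness

open Polynomial WeierstrassCurve.Affine

lemma nuOf_mul {p : Fin 6 → RatFunc ℚ} (h : p 3 + p 4 ≠ 0) :
    nuOf p * (p 3 + p 4) = p 0 - p 5 :=
  div_mul_cancel₀ _ h

/-- This is the line of slope `λ` through `R`, so `ν` and `u` together determine `v`. -/
lemma vOf_eq (p : Fin 6 → RatFunc ℚ) :
    vOf p = lambdaOf p * (uOf p - 4 * (tt ^ 2 - 1) * (tt + 1)) - 4 * tt * (tt ^ 2 - 1) ^ 2 := by
  unfold vOf uOf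
  ring

lemma zsmul_sectionP_ne_zero {n : ℤ} (hn : n ≠ 0) : n • sectionP ≠ 0 := by
  intro h
  apply hn
  apply injective_zsmul_sectionP
  simpa using h

lemma ParametrizesMultiple.exists_some {n : ℤ} {p : Fin 6 → ℤ[X]} (h : ParametrizesMultiple n p)
    (hn : n ≠ 0) : ∃ (u v : RatFunc ℚ) (hQ : genericE.toAffine.Nonsingular u v),
      n • sectionP = .some u v hQ ∧ ofIntPoly (p 3) + ofIntPoly (p 4) ≠ 0 ∧
      ofIntPoly (p 0) ≠ 0 ∧
      u = uOf (fun i => ofIntPoly (p i)) ∧ v = vOf (fun i => ofIntPoly (p i)) := by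
  have hc := h.corresponds
  have h0 := zsmul_sectionP_ne_zero hn
  rcases hQ : n • sectionP with _ | ⟨u, v, hQ'⟩
  · exact absurd hQ h0
  · rw [hQ] at hc
    exact ⟨u, v, hQ', rfl, hc⟩

lemma ParametrizesMultiple.conic {n : ℤ} {p : Fin 6 → ℤ[X]} (h : ParametrizesMultiple n p)
    (hn : n ≠ 0) {ν : RatFunc ℚ} (hν : ν = nuOf (fun i => ofIntPoly (p i))) :
    ofIntPoly (p 3) ≠ 0 ∧
    ofIntPoly (p 4) * conicA tt ν = conicB tt ν * ofIntPoly (p 3) ∧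
    ofIntPoly (p 5) * conicA tt ν = conicC tt ν * ofIntPoly (p 3) := by
  obtain ⟨u, v, hQ, hnP, hab, hx, -, -⟩ := h.exists_some hn
  have h1 : ofIntPoly (p 0) = tt * ofIntPoly (p 3) := by
    rw [h.on_fibre₁, map_mul, ofIntPoly_X]
  have h2 : tt * ofIntPoly (p 1) * ofIntPoly (p 2) = 2 * ofIntPoly (p 4) * ofIntPoly (p 5) := by
    have := congrArg ofIntPoly h.on_fibre₂
    simpa only [map_mul, map_ofNat, ofIntPoly_X] using this
  obtain ⟨h3, h4, -⟩ := h.on_surface.map ofIntPoly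
  refine ⟨right_ne_zero_of_mul (h1 ▸ hx), conic_of_fibre ?_ ?_ hab⟩
  · beta_reduce at h3 h4
    rw [h1] at h3 h4
    linear_combination h2 - tt * h4 + tt * (tt * ofIntPoly (p 3)) * h3
  · rw [hν, ← h1]
    exact nuOf_mul hab

/-- `ν` fixes a line through `R`, which meets the cubic in at most three affine points; distinct `n`
give distinct points. The polynomial `g` has the abscissas of these points as roots. -/
lemma finite_multiples_of_nu (ν : RatFunc ℚ) :
    {n : ℤ | n ≠ 0 ∧ ∃ p : Fin 6 → ℤ[X], ParametrizesMultiple n p ∧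
      nuOf (fun i => ofIntPoly (p i)) = ν}.Finite := by
  classical
  set l := (tt ^ 2 - 4) * ν + 3 * tt with hl
  set g : (RatFunc ℚ)[X] := X * (X - C (8 * tt * (tt ^ 2 - 1))) *
    (X - C ((tt ^ 2 - 1) * (tt + 2) ^ 2)) -
    (C l * (X - C (4 * (tt ^ 2 - 1) * (tt + 1))) - C (4 * tt * (tt ^ 2 - 1) ^ 2)) ^ 2 with hg
  have hg0 : g ≠ 0 := by
    have : g.natDegree = 3 := by
      rw [hg]
      compute_degree!
    rintro h
    simp [h] at this
  set f : RatFunc ℚ → genericE.toAffine.Point := fun u =>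
    if h : genericE.toAffine.Nonsingular u
      (l * (u - 4 * (tt ^ 2 - 1) * (tt + 1)) - 4 * tt * (tt ^ 2 - 1) ^ 2)
    then .some _ _ h else 0 with hf
  refine (((g.roots.toFinset.finite_toSet).image f).preimage
    injective_zsmul_sectionP.injOn).subset ?_
  rintro n ⟨hn, p, hp, hν⟩
  obtain ⟨u, v, hQ, hnP, hab, hx, hu, hv⟩ := hp.exists_some hn
  rw [vOf_eq, ← hu, lambdaOf, hν, ← hl] at hv
  subst hv
  refine ⟨u, ?_, ?_⟩
  · have hE := (genericE_equation_iff _ _).1 hQ.1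
    rw [Finset.mem_coe, Multiset.mem_toFinset, mem_roots hg0, IsRoot, hg]
    simp only [eval_sub, eval_mul, eval_X, eval_C, eval_pow]
    linear_combination -hE
  · simp only [hf]
    rw [dif_pos hQ, hnP]

lemma finite_multiples_of_eval_nu {g : (RatFunc ℚ)[X]} (hg : g ≠ 0) :
    {n : ℤ | n ≠ 0 ∧ ∃ p : Fin 6 → ℤ[X], ParametrizesMultiple n p ∧
      g.eval (nuOf (fun i => ofIntPoly (p i))) = 0}.Finite := by
  classical
  refine (g.roots.toFinset.finite_toSet.biUnion fun ν _ => finite_multiples_of_nu ν).subset ?_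
  rintro n ⟨hn, p, hp, h⟩
  simp only [Set.mem_iUnion]
  exact ⟨_, by simpa [hg] using h, hn, p, hp, rfl⟩

lemma trivialityPoly_smul {R : Type*} [CommRing R] (d a b c : R) :
    trivialityPoly (d * a) (d * b) (d * c) = d ^ 9 * trivialityPoly a b c := by
  unfold trivialityPoly
  ring

lemma finite_trivial_multiples :
    {n : ℤ | n ≠ 0 ∧ ∃ p : Fin 6 → ℤ[X], ParametrizesMultiple n p ∧
      trivialityPoly (p 3) (p 4) (p 5) = 0}.Finite := by
  set g : (RatFunc ℚ)[X] := trivialityPoly (conicA (C tt) X) (conicB (C tt) X) (conicC (C tt) X)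
    with hg
  have hev : ∀ ν, g.eval ν = trivialityPoly (conicA tt ν) (conicB tt ν) (conicC tt ν) := by
    intro ν
    rw [hg, ← coe_evalRingHom, map_trivialityPoly, map_conicA, map_conicB, map_conicC]
    simp
  have hg0 : g ≠ 0 := by
    intro h
    -- At `t = 3`, `ν = 2` the entries are 11, 21, -31, a nontrivial triple.
    have h1 := hev (ofPoly 2)
    rw [h, eval_zero, ← ofPoly_X, ← map_conicA, ← map_conicB, ← map_conicC,
      ← map_trivialityPoly] at h1
    refine ofPoly_ne_zero_of_eval (r := 3) ?_ h1.symm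
    rw [← coe_evalRingHom, map_trivialityPoly, map_conicA, map_conicB, map_conicC]
    simp only [coe_evalRingHom, eval_X, eval_ofNat]
    norm_num [trivialityPoly, conicA, conicB, conicC]
  refine (finite_multiples_of_eval_nu hg0).subset ?_
  rintro n ⟨hn, p, hp, h⟩
  refine ⟨hn, p, hp, ?_⟩
  obtain ⟨ha, hb, hc⟩ := hp.conic hn rfl
  set ν := nuOf (fun i => ofIntPoly (p i))
  rw [hev]
  have h1 := trivialityPoly_smul (ofIntPoly (p 3)) (conicA tt ν) (conicB tt ν) (conicC tt ν)
  rw [mul_comm _ (conicB tt ν), mul_comm _ (conicC tt ν), ← hb, ← hc, mul_comm (ofIntPoly (p 4)),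
    mul_comm (ofIntPoly (p 5)), mul_comm (ofIntPoly (p 3)), trivialityPoly_smul,
    ← map_trivialityPoly, h, map_zero, mul_zero] at h1
  exact (mul_eq_zero.1 h1.symm).resolve_left (pow_ne_zero 9 ha)

end Finiteness

/-! ### Integral matrices from specialization -/

section Matrices

open Polynomial

lemma charpoly_symZeroDiag {R : Type*} [CommRing R] {x y z a b c : R}
    (h : SatisfiesSurfaceEquations ![x, y, z, a, b, c]) :
    (symZeroDiag a b c).charpoly = (X - C x) * (X - C y) * (X - C z) := by
  obtain ⟨h1, h2, h3⟩ := h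
  simp only [Matrix.cons_val] at h1 h2 h3
  have h1' : C x + C y + C z = 0 := by simpa using congrArg C h1
  have h2' : C x * C y + C y * C z + C z * C x = -C a ^ 2 - C b ^ 2 - C c ^ 2 := by
    simpa using congrArg C h2
  have h3' : C x * C y * C z = 2 * C a * C b * C c := by
    simpa only [map_mul, map_ofNat] using congrArg C h3
  rw [Matrix.charpoly, Matrix.det_fin_three]
  simp [symZeroDiag]
  linear_combination X ^ 2 * h1' - X * h2' + h3'

lemma SatisfiesSurfaceEquations.eval {p : Fin 6 → ℤ[X]} (h : SatisfiesSurfaceEquations p)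
    (m : ℤ) : SatisfiesSurfaceEquations fun i => (p i).eval m :=
  h.map (evalRingHom m)

lemma charpoly_specializedMatrix {p : Fin 6 → ℤ[X]} (h : SatisfiesSurfaceEquations p) (m : ℤ) :
    (specializedMatrix p m).charpoly =
      (X - C ((p 0).eval m)) * (X - C ((p 1).eval m)) * (X - C ((p 2).eval m)) :=
  charpoly_symZeroDiag (h.eval m)

lemma aeval_charpoly_of_hasEigenvalue {M : Matrix (Fin 3) (Fin 3) ℤ} {μ : ℂ}
    (h : Module.End.HasEigenvalue (Matrix.toLin' (M.map (Int.cast : ℤ → ℂ))) μ) :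
    aeval μ M.charpoly = 0 := by
  rw [Module.End.hasEigenvalue_iff_isRoot_charpoly, Matrix.charpoly_toLin'] at h
  have : M.map (Int.cast : ℤ → ℂ) = M.map (Int.castRingHom ℂ) := rfl
  rwa [this, Matrix.charpoly_map, IsRoot, eval_map] at h

lemma hasIntegralEigenvalues_of_charpoly {M : Matrix (Fin 3) (Fin 3) ℤ} {x y z : ℤ}
    (h : M.charpoly = (X - C x) * (X - C y) * (X - C z)) : HasIntegralEigenvalues M := by
  intro μ hμ
  have h1 := aeval_charpoly_of_hasEigenvalue hμ
  rw [h] at h1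
  simp only [map_mul, map_sub, aeval_X, aeval_C, mul_eq_zero, sub_eq_zero] at h1
  rcases h1 with (h1 | h1) | h1
  exacts [⟨x, h1⟩, ⟨y, h1⟩, ⟨z, h1⟩]

lemma isNontrivialIntegralMatrix_symZeroDiag {a b c : ℤ}
    (h : HasIntegralEigenvalues (symZeroDiag a b c)) (h0 : trivialityPoly a b c ≠ 0) :
    IsNontrivialIntegralMatrix (symZeroDiag a b c) := by
  refine ⟨?_, ?_, h, ?_⟩
  · ext i j
    fin_cases i <;> fin_cases j <;> rfl
  · intro i
    fin_cases i <;> rfl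
  · simpa [symZeroDiag] using h0

/-- An eigenvalue of `M` is rational, being an integer divided by `d`, and is an algebraic integer.
-/
lemma HasIntegralEigenvalues.of_smul {M : Matrix (Fin 3) (Fin 3) ℤ} {d : ℤ} (hd : d ≠ 0)
    (h : HasIntegralEigenvalues (d • M)) : HasIntegralEigenvalues M := by
  intro μ hμ
  have h1 : Module.End.HasEigenvalue
      (Matrix.toLin' ((d • M).map (Int.cast : ℤ → ℂ))) (d * μ) := by
    obtain ⟨w, hw⟩ := hμ.exists_hasEigenvector
    refine Module.End.hasEigenvalue_of_hasEigenvector (x := w)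
      ⟨Module.End.mem_eigenspace_iff.2 ?_, hw.2⟩
    have : (d • M).map (Int.cast : ℤ → ℂ) = (d : ℂ) • M.map (Int.cast : ℤ → ℂ) := by
      ext i j
      rw [Matrix.map_apply, Matrix.smul_apply, Matrix.smul_apply, Matrix.map_apply, smul_eq_mul,
        smul_eq_mul, Int.cast_mul]
    rw [this, map_smul, LinearMap.smul_apply, hw.apply_eq_smul, smul_smul]
  obtain ⟨k, hk⟩ := h _ h1
  have hd' : (d : ℂ) ≠ 0 := by exact_mod_cast hd
  have hμ' : μ = algebraMap ℚ ℂ (k / d) := by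
    rw [eq_ratCast]
    push_cast
    rw [eq_div_iff hd', ← hk]
    ring
  have hint : IsIntegral ℤ μ :=
    ⟨M.charpoly, M.charpoly_monic, aeval_charpoly_of_hasEigenvalue hμ⟩
  rw [hμ', isIntegral_algebraMap_iff (algebraMap ℚ ℂ).injective,
    IsIntegrallyClosed.isIntegral_iff] at hint
  obtain ⟨z, hz⟩ := hint
  exact ⟨z, by rw [hμ', ← hz]; simp⟩

lemma exists_primitive_symZeroDiag {a b c : ℤ} (ha : a ≠ 0) :
    ∃ d a' b' c' : ℤ, d ≠ 0 ∧ a = d * a' ∧ b = d * b' ∧ c = d * c' ∧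
      IsPrimitiveMatrix (symZeroDiag a' b' c') := by
  obtain ⟨g, hg, hg1⟩ := Finset.extract_gcd ![a, b, c] (Finset.univ_nonempty (α := Fin 3))
  refine ⟨_, g 0, g 1, g 2, ?_, hg 0 (Finset.mem_univ _), hg 1 (Finset.mem_univ _),
    hg 2 (Finset.mem_univ _), ?_⟩
  · intro h
    apply ha
    have := hg 0 (Finset.mem_univ _)
    rw [h, zero_mul] at this
    exact this
  · intro e he
    rw [isUnit_iff_dvd_one, ← hg1]
    refine Finset.dvd_gcd fun i _ => ?_
    fin_cases i
    exacts [he 0 1, he 0 2, he 1 2]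

lemma smul_symZeroDiag {R : Type*} [CommRing R] (d a b c : R) :
    d • symZeroDiag a b c = symZeroDiag (d * a) (d * b) (d * c) := by
  ext i j
  fin_cases i <;> fin_cases j <;> simp [symZeroDiag]

lemma isNontrivialIntegralMatrix_specializedMatrix {p : Fin 6 → ℤ[X]}
    (h : SatisfiesSurfaceEquations p) {m : ℤ}
    (hm : (trivialityPoly (p 3) (p 4) (p 5)).eval m ≠ 0) :
    IsNontrivialIntegralMatrix (specializedMatrix p m) := by
  refine isNontrivialIntegralMatrix_symZeroDiag
    (hasIntegralEigenvalues_of_charpoly (charpoly_specializedMatrix h m)) ?_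
  rwa [← coe_evalRingHom, map_trivialityPoly] at hm

lemma finite_eval_eq_zero {f : ℤ[X]} (hf : f ≠ 0) : {m : ℤ | f.eval m = 0}.Finite :=
  (Polynomial.finite_setOfPred_isRoot hf)

lemma finite_trivial_specializations {p : Fin 6 → ℤ[X]} (h : SatisfiesSurfaceEquations p)
    (h0 : trivialityPoly (p 3) (p 4) (p 5) ≠ 0) :
    {m : ℤ | ¬ IsNontrivialIntegralMatrix (specializedMatrix p m)}.Finite := by
  refine (finite_eval_eq_zero h0).subset fun m hm => ?_
  by_contra h1
  exact hm (isNontrivialIntegralMatrix_specializedMatrix h h1)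

/-- Since `x = ta`, the number `m * M 0 1` is an eigenvalue of `M`, so `m` is a root of the nonzero
cubic `f`. -/
lemma finite_specializations_of_smul {p : Fin 6 → ℤ[X]} (h : SatisfiesSurfaceEquations p)
    (hx : p 0 = X * p 3) {M : Matrix (Fin 3) (Fin 3) ℤ} (hM : M 0 1 ≠ 0) :
    {m : ℤ | ∃ k : ℤ, k ≠ 0 ∧ specializedMatrix p m = k • M}.Finite := by
  set f : ℤ[X] := C (M 0 1 ^ 3) * X ^ 3 -
    C (M 0 1 * (M 0 1 ^ 2 + M 0 2 ^ 2 + M 1 2 ^ 2)) * X - C (2 * M 0 1 * M 0 2 * M 1 2) with hf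
  have hf0 : f ≠ 0 := by
    have : f.natDegree = 3 := by
      rw [hf]
      compute_degree!
    rintro h
    simp [h] at this
  refine (finite_eval_eq_zero hf0).subset ?_
  rintro m ⟨k, hk, e⟩
  obtain ⟨h1, h2, h3⟩ := h.eval m
  have e1 : (p 3).eval m = k * M 0 1 := congrFun (congrFun e 0) 1
  have e2 : (p 4).eval m = k * M 0 2 := congrFun (congrFun e 0) 2
  have e3 : (p 5).eval m = k * M 1 2 := congrFun (congrFun e 1) 2
  have e0 : (p 0).eval m = m * (k * M 0 1) := by rw [hx, eval_mul, eval_X, e1]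
  beta_reduce at h1 h2 h3
  rw [e0] at h1 h2 h3
  rw [e1, e2, e3] at h2 h3
  simp only [Set.mem_ofPred_eq, hf, eval_sub, eval_mul, eval_pow, eval_C, eval_X]
  apply mul_left_cancel₀ (pow_ne_zero 3 hk)
  linear_combination (m * (k * M 0 1)) ^ 2 * h1 - (m * (k * M 0 1)) * h2 + h3

/-- Every `m` outside a finite set yields a primitive matrix, and each primitive matrix absorbs only
finitely many `m`. -/
lemma infinite_primitive_of_nontrivial {p : Fin 6 → ℤ[X]} (h : SatisfiesSurfaceEquations p)
    (hx : p 0 = X * p 3) (h0 : trivialityPoly (p 3) (p 4) (p 5) ≠ 0) :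
    {M : Matrix (Fin 3) (Fin 3) ℤ | IsNontrivialIntegralMatrix M ∧ IsPrimitiveMatrix M ∧
      ∃ m k : ℤ, k ≠ 0 ∧ specializedMatrix p m = k • M}.Infinite := by
  intro hfin
  have h1 : (⋃ M ∈ {M : Matrix (Fin 3) (Fin 3) ℤ | IsNontrivialIntegralMatrix M ∧
      IsPrimitiveMatrix M ∧ ∃ m k : ℤ, k ≠ 0 ∧ specializedMatrix p m = k • M},
      {m : ℤ | ∃ k : ℤ, k ≠ 0 ∧ specializedMatrix p m = k • M}).Finite := by
    refine hfin.biUnion fun M hM => finite_specializations_of_smul h hx ?_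
    intro h01
    apply hM.1.2.2.2
    rw [h01]
    simp [trivialityPoly]
  refine (Set.infinite_univ (α := ℤ)) (((finite_eval_eq_zero h0).union h1).subset fun m _ => ?_)
  by_cases hm : (trivialityPoly (p 3) (p 4) (p 5)).eval m = 0
  · exact Or.inl hm
  right
  have hM := isNontrivialIntegralMatrix_specializedMatrix h hm
  have ha : (p 3).eval m ≠ 0 := by
    intro ha
    apply hM.2.2.2
    simp [specializedMatrix, symZeroDiag, trivialityPoly, ha]
  obtain ⟨d, a, b, c, hd, ea, eb, ec, hprim⟩ :=
    exists_primitive_symZeroDiag (b := (p 4).eval m) (c := (p 5).eval m) ha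
  have e : specializedMatrix p m = d • symZeroDiag a b c := by
    rw [smul_symZeroDiag, ← ea, ← eb, ← ec]
    rfl
  simp only [Set.mem_iUnion]
  refine ⟨symZeroDiag a b c, ⟨isNontrivialIntegralMatrix_symZeroDiag ?_ ?_, hprim, m, d, hd, e⟩,
    d, hd, e⟩
  · exact (e ▸ hM.2.2.1).of_smul hd
  · intro h2
    apply hm
    rw [← coe_evalRingHom, map_trivialityPoly]
    simp only [coe_evalRingHom]
    rw [ea, eb, ec, trivialityPoly_smul, h2, mul_zero]

lemma parametrizesMultiple_one : ParametrizesMultiple 1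
    ![Polynomial.X ^ 2, 2 - Polynomial.X ^ 2, -2, Polynomial.X, Polynomial.X ^ 2 - 2,
      Polynomial.X] := by
  have h2 : ofPoly (X + 2) ≠ 0 := ofPoly_ne_zero_of_eval (r := 0) (by norm_num)
  have h1 : ofPoly (X - 1) ≠ 0 := ofPoly_ne_zero_of_eval (r := 0) (by norm_num)
  simp only [map_add, map_sub, map_ofNat, map_one, ofPoly_X] at h1 h2
  have ht := tt_ne_zero
  refine ⟨?_, ?_, ?_, ?_, ?_⟩
  -- A divisor of `-2` is constant, and a constant dividing `X` is a unit.
  · intro d hd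
    have h3 : d ∣ X := hd 3
    have h2 : d ∣ C (-2) := by simpa using hd 2
    have hdeg : d.natDegree = 0 := by
      have := natDegree_le_of_dvd h2 (by simp)
      simpa using this
    rw [eq_C_of_natDegree_eq_zero hdeg] at h3 ⊢
    have := C_dvd_iff_dvd_coeff _ _ |>.1 h3 1
    rw [coeff_X_one] at this
    exact (isUnit_iff_dvd_one.2 this).map C
  · refine ⟨?_, ?_, ?_⟩ <;> simp only [Matrix.cons_val] <;> ring
  · simp only [Matrix.cons_val]
    ring
  · simp only [Matrix.cons_val]
    ring
  · rw [one_zsmul]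
    have hv : (fun i => algebraMap ℚ[X] (RatFunc ℚ) (((![X ^ 2, 2 - X ^ 2, -2, X, X ^ 2 - 2, X] :
        Fin 6 → ℤ[X]) i).map (Int.castRingHom ℚ))) =
        ![tt ^ 2, 2 - tt ^ 2, -2, tt, tt ^ 2 - 2, tt] := by
      have hX : algebraMap ℚ[X] (RatFunc ℚ) X = tt := ofPoly_X
      have h2 : algebraMap ℚ[X] (RatFunc ℚ) 2 = 2 := map_ofNat _ 2
      funext i
      fin_cases i <;> simp [hX, h2, -RatFunc.algebraMap_X]
    rw [hv]
    have hab : tt + (tt ^ 2 - 2) ≠ 0 := by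
      have : tt + (tt ^ 2 - 2) = (tt + 2) * (tt - 1) := by ring
      rw [this]
      exact mul_ne_zero h2 h1
    have hnu : nuOf ![tt ^ 2, 2 - tt ^ 2, -2, tt, tt ^ 2 - 2, tt] = tt / (tt + 2) := by
      simp only [nuOf, Matrix.cons_val]
      rw [div_eq_div_iff hab h2]
      ring
    have hl : lambdaOf ![tt ^ 2, 2 - tt ^ 2, -2, tt, tt ^ 2 - 2, tt] = tt * (tt + 1) := by
      rw [lambdaOf, hnu]
      field_simp
      ring
    have hm : muOf ![tt ^ 2, 2 - tt ^ 2, -2, tt, tt ^ 2 - 2, tt] =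
        2 * (2 * tt ^ 3 * (tt + 1)) - (tt * (tt + 1)) ^ 2 - tt * (tt ^ 2 - 1) * (tt + 8) := by
      rw [muOf, hnu]
      simp only [Matrix.cons_val]
      field_simp
      ring
    refine ⟨by simpa only [Matrix.cons_val] using hab, ?_, ?_, ?_⟩
    · simpa only [Matrix.cons_val] using pow_ne_zero 2 ht
    · rw [uOf, hm, hl]
      ring
    · rw [vOf, hm, hl]
      ring

end Matrices

/-! ### Normal forms modulo the equations of the surface -/

section NormalForm

open MvPolynomial

/-- The inclusion of polynomials in `a, b, c` into those in `x, y, z, a, b, c`. -/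
noncomputable def entriesHom : MvPolynomial (Fin 3) ℚ →ₐ[ℚ] MvPolynomial (Fin 6) ℚ :=
  aeval ![X 3, X 4, X 5]

/-- The combination `(f₀ + f₁ x + f₂ x²) + (g₀ + g₁ x + g₂ x²) y`. -/
def cubicQuadraticForm {B : Type*} [CommRing B] (x y f₀ f₁ f₂ g₀ g₁ g₂ : B) : B :=
  f₀ + f₁ * x + f₂ * x ^ 2 + (g₀ + g₁ * x + g₂ * x ^ 2) * y

/-- Modulo the equations of the surface, `F` is a combination of the `xⁱ yʲ`, `i < 3`, `j < 2`,
with coefficients in `ℚ[a, b, c]`. -/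
def HasNormalForm (F : MvPolynomial (Fin 6) ℚ) : Prop :=
  ∃ f₀ f₁ f₂ g₀ g₁ g₂ : MvPolynomial (Fin 3) ℚ, ∀ (B : Type) [CommRing B]
    (φ : MvPolynomial (Fin 6) ℚ →+* B), SatisfiesSurfaceEquations (fun i => φ (X i)) →
    φ F = cubicQuadraticForm (φ (X 0)) (φ (X 1)) (φ (entriesHom f₀)) (φ (entriesHom f₁))
      (φ (entriesHom f₂)) (φ (entriesHom g₀)) (φ (entriesHom g₁)) (φ (entriesHom g₂))

lemma entriesHom_X_zero : entriesHom (X 0) = X 3 := by simp [entriesHom]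
lemma entriesHom_X_one : entriesHom (X 1) = X 4 := by simp [entriesHom]
lemma entriesHom_X_two : entriesHom (X 2) = X 5 := by simp [entriesHom]

lemma HasNormalForm.entries (f : MvPolynomial (Fin 3) ℚ) : HasNormalForm (entriesHom f) :=
  ⟨f, 0, 0, 0, 0, 0, fun B _ φ _ => by simp [cubicQuadraticForm]⟩

lemma HasNormalForm.add {F G : MvPolynomial (Fin 6) ℚ} (hF : HasNormalForm F)
    (hG : HasNormalForm G) : HasNormalForm (F + G) := by
  obtain ⟨f₀, f₁, f₂, g₀, g₁, g₂, h⟩ := hF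
  obtain ⟨f₀', f₁', f₂', g₀', g₁', g₂', h'⟩ := hG
  refine ⟨f₀ + f₀', f₁ + f₁', f₂ + f₂', g₀ + g₀', g₁ + g₁', g₂ + g₂', fun B _ φ hφ => ?_⟩
  rw [map_add, h B φ hφ, h' B φ hφ]
  simp only [cubicQuadraticForm, map_add]
  ring

lemma HasNormalForm.entries_mul {F : MvPolynomial (Fin 6) ℚ} (hF : HasNormalForm F)
    (f : MvPolynomial (Fin 3) ℚ) : HasNormalForm (entriesHom f * F) := by
  obtain ⟨f₀, f₁, f₂, g₀, g₁, g₂, h⟩ := hF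
  refine ⟨f * f₀, f * f₁, f * f₂, f * g₀, f * g₁, f * g₂, fun B _ φ hφ => ?_⟩
  rw [map_mul, h B φ hφ]
  simp only [cubicQuadraticForm, map_mul]
  ring

/-- On the surface `x` is an eigenvalue: `x³ = s x + e`. -/
lemma HasNormalForm.mul_X_zero {F : MvPolynomial (Fin 6) ℚ} (hF : HasNormalForm F) :
    HasNormalForm (F * X 0) := by
  obtain ⟨f₀, f₁, f₂, g₀, g₁, g₂, h⟩ := hF
  set e : MvPolynomial (Fin 3) ℚ := 2 * X 0 * X 1 * X 2 with he
  set s : MvPolynomial (Fin 3) ℚ := X 0 ^ 2 + X 1 ^ 2 + X 2 ^ 2 with hs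
  refine ⟨e * f₂, f₀ + s * f₂, f₁, e * g₂, g₀ + s * g₂, g₁, fun B _ φ hφ => ?_⟩
  rw [map_mul, h B φ hφ]
  obtain ⟨h1, h2, h3⟩ := hφ
  simp only [cubicQuadraticForm, he, hs, map_mul, map_add, map_pow, map_ofNat, entriesHom_X_zero,
    entriesHom_X_one, entriesHom_X_two]
  linear_combination (φ (entriesHom f₂) + φ (entriesHom g₂) * φ (X 1)) *
    (φ (X 0) ^ 2 * h1 - φ (X 0) * h2 + h3)

lemma HasNormalForm.mul_X_one {F : MvPolynomial (Fin 6) ℚ} (hF : HasNormalForm F) :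
    HasNormalForm (F * X 1) := by
  obtain ⟨f₀, f₁, f₂, g₀, g₁, g₂, h⟩ := hF
  set e : MvPolynomial (Fin 3) ℚ := 2 * X 0 * X 1 * X 2 with he
  set s : MvPolynomial (Fin 3) ℚ := X 0 ^ 2 + X 1 ^ 2 + X 2 ^ 2 with hs
  refine ⟨s * g₀ - e * g₁, - e * g₂, - g₀, f₀ - e * g₂, f₁ - g₀ - s * g₂, f₂ - g₁,
    fun B _ φ hφ => ?_⟩
  rw [map_mul, h B φ hφ]
  obtain ⟨h1, h2, h3⟩ := hφ
  simp only [cubicQuadraticForm, he, hs, map_mul, map_add, map_sub, map_neg, map_pow, map_ofNat,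
    entriesHom_X_zero, entriesHom_X_one, entriesHom_X_two]
  -- `hy` removes `y²`; the powers `x³` and `x⁴` that this creates are removed by `hx`.
  have hy : φ (X 1) ^ 2 + φ (X 0) * φ (X 1) + φ (X 0) ^ 2 =
      φ (X 3) ^ 2 + φ (X 4) ^ 2 + φ (X 5) ^ 2 := by
    linear_combination (φ (X 0) + φ (X 1)) * h1 - h2
  have hx : φ (X 0) ^ 3 - (φ (X 3) ^ 2 + φ (X 4) ^ 2 + φ (X 5) ^ 2) * φ (X 0) =
      2 * φ (X 3) * φ (X 4) * φ (X 5) := by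
    linear_combination φ (X 0) ^ 2 * h1 - φ (X 0) * h2 + h3
  linear_combination (φ (entriesHom g₀) + φ (entriesHom g₁) * φ (X 0) +
    φ (entriesHom g₂) * φ (X 0) ^ 2) * hy - (φ (entriesHom g₁) +
    φ (entriesHom g₂) * φ (X 0) + φ (entriesHom g₂) * φ (X 1)) * hx

lemma HasNormalForm.congr {F G : MvPolynomial (Fin 6) ℚ} (hF : HasNormalForm F)
    (h : ∀ (B : Type) [CommRing B] (φ : MvPolynomial (Fin 6) ℚ →+* B),
      SatisfiesSurfaceEquations (fun i => φ (X i)) → φ G = φ F) : HasNormalForm G := by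
  obtain ⟨f₀, f₁, f₂, g₀, g₁, g₂, h'⟩ := hF
  exact ⟨f₀, f₁, f₂, g₀, g₁, g₂, fun B _ φ hφ => (h B φ hφ).trans (h' B φ hφ)⟩

lemma hasNormalForm (F : MvPolynomial (Fin 6) ℚ) : HasNormalForm F := by
  induction F using MvPolynomial.induction_on with
  | C r => simpa [entriesHom] using HasNormalForm.entries (C r)
  | add F G hF hG => exact hF.add hG
  | mul_X F i hF =>
    fin_cases i
    · exact hF.mul_X_zero
    · exact hF.mul_X_one
    · refine ((hF.mul_X_zero.add hF.mul_X_one).entries_mul (-1)).congr fun B _ φ hφ => ?_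
      have h1 := hφ.1
      simp only [map_mul, map_add, map_neg, map_one]
      change φ F * φ (X 2) = _
      linear_combination φ F * h1
    · simpa [entriesHom_X_zero, mul_comm] using hF.entries_mul (X 0)
    · simpa [entriesHom_X_one, mul_comm] using hF.entries_mul (X 1)
    · simpa [entriesHom_X_two, mul_comm] using hF.entries_mul (X 2)

end NormalForm

/-! ### The generic characteristic polynomial has Galois group `S₃` -/

section FunctionField

open Polynomial

/-- The polynomial ring `ℚ[a, b, c]`. -/
abbrev EntryRing : Type := MvPolynomial (Fin 3) ℚ

/-- The function field `ℚ(a, b, c)`. -/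
abbrev EntryField : Type := FractionRing EntryRing

/-- The sum of squares `a² + b² + c²`. -/
noncomputable def sumSq : EntryRing :=
  MvPolynomial.X 0 ^ 2 + MvPolynomial.X 1 ^ 2 + MvPolynomial.X 2 ^ 2

/-- The product `2abc`. -/
noncomputable def twiceProd : EntryRing :=
  2 * MvPolynomial.X 0 * MvPolynomial.X 1 * MvPolynomial.X 2

/-- The characteristic polynomial `T³ - (a² + b² + c²) T - 2abc` of the generic matrix. -/
noncomputable def genericCharpoly : EntryRing[X] :=
  X ^ 3 - C sumSq * X - C twiceProd

lemma genericCharpoly_monic : genericCharpoly.Monic := by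
  unfold genericCharpoly
  monicity!

lemma natDegree_genericCharpoly : genericCharpoly.natDegree = 3 := by
  unfold genericCharpoly
  compute_degree!

lemma no_rational_root (r : ℚ) : r ^ 3 - 14 * r - 12 ≠ 0 := by
  intro h
  have hint : IsIntegral ℤ r := by
    refine ⟨X ^ 3 - C 14 * X - C 12, by monicity!, ?_⟩
    simpa using h
  obtain ⟨z, rfl⟩ := IsIntegrallyClosed.isIntegral_iff.1 hint
  have hz : z ^ 3 - 14 * z - 12 = 0 := by
    simp only [eq_intCast] at h
    exact_mod_cast h
  have h1 : z < 5 := by nlinarith [sq_nonneg (z + 5), sq_nonneg z]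
  have h2 : -5 < z := by nlinarith [sq_nonneg (z - 5), sq_nonneg z]
  interval_cases z <;> omega

/-- A root in the fraction field would be a polynomial in `a, b, c`; at `(1, 2, 3)` it would be a
rational root of `T³ - 14T - 12`. -/
lemma irreducible_genericCharpoly :
    Irreducible (genericCharpoly.map (algebraMap EntryRing EntryField)) := by
  have hm := genericCharpoly_monic.map (algebraMap EntryRing EntryField)
  have hd : (genericCharpoly.map (algebraMap EntryRing EntryField)).natDegree = 3 := by
    rw [genericCharpoly_monic.natDegree_map, natDegree_genericCharpoly]
  rw [irreducible_iff_roots_eq_zero_of_degree_le_three (by omega) (by omega)]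
  rw [Multiset.eq_zero_iff_forall_notMem]
  intro r hr
  have hr' : aeval r genericCharpoly = 0 := by
    have := isRoot_of_mem_roots hr
    rwa [IsRoot, eval_map_algebraMap] at this
  obtain ⟨s, rfl⟩ := IsIntegrallyClosed.isIntegral_iff.1
    (⟨_, genericCharpoly_monic, hr'⟩ : IsIntegral EntryRing r)
  rw [aeval_algebraMap_apply, map_eq_zero_iff _ (IsFractionRing.injective _ _)] at hr'
  have h := congrArg (MvPolynomial.eval ![1, 2, 3]) hr'
  simp only [genericCharpoly, sumSq, twiceProd, map_sub, map_mul, map_add, map_pow, aeval_X,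
    aeval_C, Algebra.algebraMap_self, RingHom.id_apply, MvPolynomial.eval_X, Matrix.cons_val,
    map_ofNat, map_zero] at h
  apply no_rational_root (MvPolynomial.eval ![1, 2, 3] s)
  linear_combination h

/-- At `(1, 2, 3)` the discriminant is 7088, which is not a square. -/
lemma discriminant_not_isSquare (δ : EntryField) :
    δ ^ 2 ≠ algebraMap EntryRing EntryField (4 * sumSq ^ 3 - 27 * twiceProd ^ 2) := by
  intro h
  obtain ⟨s, rfl⟩ := IsIntegrallyClosed.exists_algebraMap_eq_of_isIntegral_pow
    (R := EntryRing) (K := EntryField) (x := δ) (n := 2) two_pos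
    (by rw [h]; exact isIntegral_algebraMap)
  rw [← map_pow] at h
  have h := congrArg (MvPolynomial.eval ![1, 2, 3]) (IsFractionRing.injective _ _ h)
  simp only [sumSq, twiceProd, map_sub, map_mul, map_add, map_pow,
    MvPolynomial.eval_X, Matrix.cons_val, map_ofNat] at h
  have : IsSquare (7088 : ℚ) := ⟨MvPolynomial.eval ![1, 2, 3] s, by linear_combination -h⟩
  rw [Rat.isSquare_iff] at this
  norm_num at this

end FunctionField

/-! ### The generic point and elimination down to `a, b, c` -/

section Eliminant

open Polynomial

/-- An algebraic closure of `ℚ(a, b, c)`. -/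
abbrev EntryClosure : Type := AlgebraicClosure EntryField

variable {x y : EntryClosure}

lemma minpoly_of_aeval_genericCharpoly (hx : aeval x genericCharpoly = 0) :
    minpoly EntryField x = genericCharpoly.map (algebraMap EntryRing EntryField) := by
  refine (minpoly.eq_of_irreducible_of_monic irreducible_genericCharpoly ?_
    (genericCharpoly_monic.map _)).symm
  rwa [aeval_map_algebraMap]

lemma natDegree_minpoly (hx : aeval x genericCharpoly = 0) :
    (minpoly EntryField x).natDegree = 3 := by
  rw [minpoly_of_aeval_genericCharpoly hx, genericCharpoly_monic.natDegree_map,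
    natDegree_genericCharpoly]

lemma coeffs_eq_zero (hx : aeval x genericCharpoly = 0) {f₀ f₁ f₂ : EntryRing}
    (h : algebraMap EntryRing EntryClosure f₀ + algebraMap EntryRing EntryClosure f₁ * x +
      algebraMap EntryRing EntryClosure f₂ * x ^ 2 = 0) : f₀ = 0 ∧ f₁ = 0 ∧ f₂ = 0 := by
  set q : EntryRing[X] := C f₂ * X ^ 2 + C f₁ * X + C f₀ with hq
  have hq0 : q.map (algebraMap EntryRing EntryField) = 0 := by
    by_contra hne
    have h1 := natDegree_le_of_dvd (minpoly.dvd EntryField x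
      (p := q.map (algebraMap EntryRing EntryField)) ?_) hne
    · rw [natDegree_minpoly hx] at h1
      have h2 : q.natDegree ≤ 2 := natDegree_quadratic_le
      have h3 := natDegree_map_le (p := q) (f := algebraMap EntryRing EntryField)
      omega
    · rw [aeval_map_algebraMap, hq]
      simp only [map_add, map_mul, map_pow, aeval_C, aeval_X]
      linear_combination h
  rw [Polynomial.map_eq_zero_iff (IsFractionRing.injective EntryRing EntryField)] at hq0
  refine ⟨?_, ?_, ?_⟩
  · simpa [hq] using congrArg (coeff · 0) hq0
  · simpa [hq] using congrArg (coeff · 1) hq0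
  · simpa [hq, coeff_X, coeff_C] using congrArg (coeff · 2) hq0

/-- If `y` lay in the cubic field of `x`, so would the square root `δ = (x - y)(y - z)(z - x)` of
the discriminant, with `z = -x - y`. Its degree divides 3 and is at most 2, so it would lie in the
base field. -/
lemma not_mem_adjoin (hx : aeval x genericCharpoly = 0)
    (hy : y ^ 2 + x * y + x ^ 2 = algebraMap EntryRing EntryClosure sumSq) :
    y ∉ IntermediateField.adjoin EntryField {x} := by
  intro hmem
  have hxm : x ∈ IntermediateField.adjoin EntryField {x} :=
    IntermediateField.mem_adjoin_simple_self _ _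
  set L := IntermediateField.adjoin EntryField {x} with hL
  have hfin : Module.finrank EntryField L = 3 := by
    rw [IntermediateField.adjoin.finrank (Algebra.IsIntegral.isIntegral x), natDegree_minpoly hx]
  have : FiniteDimensional EntryField L := .of_finrank_pos (by omega)
  set X' : L := ⟨x, hxm⟩
  set Y' : L := ⟨y, hmem⟩
  set δ : L := (X' - Y') * (2 * Y' + X') * (-2 * X' - Y') with hδ
  have hδ2 : δ ^ 2 = algebraMap EntryField L
      (algebraMap EntryRing EntryField (4 * sumSq ^ 3 - 27 * twiceProd ^ 2)) := by
    apply Subtype.ext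
    have e : ((algebraMap EntryField L (algebraMap EntryRing EntryField
        (4 * sumSq ^ 3 - 27 * twiceProd ^ 2)) : L) : EntryClosure) =
        algebraMap EntryRing EntryClosure (4 * sumSq ^ 3 - 27 * twiceProd ^ 2) := rfl
    rw [e]
    have e2 : ((δ ^ 2 : L) : EntryClosure) =
        ((x - y) * (2 * y + x) * (-2 * x - y)) ^ 2 := rfl
    rw [e2]
    simp only [map_sub, map_mul, map_pow, map_ofNat]
    have hx' : x ^ 3 - algebraMap EntryRing EntryClosure sumSq * x =
        algebraMap EntryRing EntryClosure twiceProd := by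
      simp only [genericCharpoly, map_sub, map_mul, map_pow, aeval_X, aeval_C] at hx
      linear_combination hx
    rw [← hx', ← hy]
    ring
  have hdeg : (minpoly EntryField δ).natDegree ∣ 3 := by
    have h := minpoly.degree_dvd (K := EntryField) (Algebra.IsIntegral.isIntegral δ)
    rw [hfin] at h
    convert h
  have hle : (minpoly EntryField δ).natDegree ≤ 2 := by
    refine (natDegree_le_of_dvd (minpoly.dvd EntryField δ (p := X ^ 2 - C
      (algebraMap EntryRing EntryField (4 * sumSq ^ 3 - 27 * twiceProd ^ 2))) ?_) ?_).trans
      (natDegree_X_pow_sub_C).le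
    · rw [map_sub, map_pow, aeval_X, aeval_C, hδ2, sub_self]
    · exact X_pow_sub_C_ne_zero two_pos _
  have h1 : (minpoly EntryField δ).natDegree = 1 := by
    rcases (Nat.dvd_prime Nat.prime_three).1 hdeg with h | h <;> omega
  obtain ⟨d, hd⟩ := minpoly.natDegree_eq_one_iff.1 h1
  apply discriminant_not_isSquare d
  apply (algebraMap EntryField L).injective
  rw [map_pow, hd, hδ2]

/-- A nonzero coefficient of `y` would express `y` as an element of the field generated by `x`. -/
lemma coeffs_eq_zero_of_cubicQuadraticForm (hx : aeval x genericCharpoly = 0)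
    (hy : y ^ 2 + x * y + x ^ 2 = algebraMap EntryRing EntryClosure sumSq)
    {f₀ f₁ f₂ g₀ g₁ g₂ : EntryRing}
    (h : cubicQuadraticForm x y (algebraMap EntryRing EntryClosure f₀)
      (algebraMap EntryRing EntryClosure f₁) (algebraMap EntryRing EntryClosure f₂)
      (algebraMap EntryRing EntryClosure g₀) (algebraMap EntryRing EntryClosure g₁)
      (algebraMap EntryRing EntryClosure g₂) = 0) :
    (f₀ = 0 ∧ f₁ = 0 ∧ f₂ = 0) ∧ g₀ = 0 ∧ g₁ = 0 ∧ g₂ = 0 := by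
  unfold cubicQuadraticForm at h
  have hxm : x ∈ IntermediateField.adjoin EntryField {x} :=
    IntermediateField.mem_adjoin_simple_self _ _
  have hr : ∀ f : EntryRing, algebraMap EntryRing EntryClosure f ∈
      IntermediateField.adjoin EntryField {x} := fun f => by
    rw [IsScalarTower.algebraMap_apply EntryRing EntryField EntryClosure]
    exact IntermediateField.algebraMap_mem _ _
  have hcomb : ∀ f₀ f₁ f₂ : EntryRing, algebraMap EntryRing EntryClosure f₀ +
      algebraMap EntryRing EntryClosure f₁ * x + algebraMap EntryRing EntryClosure f₂ * x ^ 2 ∈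
      IntermediateField.adjoin EntryField {x} := fun f₀ f₁ f₂ =>
    add_mem (add_mem (hr _) (mul_mem (hr _) hxm)) (mul_mem (hr _) (pow_mem hxm 2))
  by_cases hg : algebraMap EntryRing EntryClosure g₀ + algebraMap EntryRing EntryClosure g₁ * x +
      algebraMap EntryRing EntryClosure g₂ * x ^ 2 = 0
  · rw [hg, zero_mul, add_zero] at h
    exact ⟨coeffs_eq_zero hx h, coeffs_eq_zero hx hg⟩
  · exfalso
    apply not_mem_adjoin hx hy
    have : y = -(algebraMap EntryRing EntryClosure f₀ + algebraMap EntryRing EntryClosure f₁ * x +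
        algebraMap EntryRing EntryClosure f₂ * x ^ 2) / (algebraMap EntryRing EntryClosure g₀ +
        algebraMap EntryRing EntryClosure g₁ * x +
        algebraMap EntryRing EntryClosure g₂ * x ^ 2) := by
      rw [eq_div_iff hg]
      linear_combination h
    rw [this]
    exact div_mem (neg_mem (hcomb _ _ _)) (hcomb _ _ _)

/-- There is a generic point of the surface over the algebraic closure of `ℚ(a, b, c)`: it
satisfies the equations, and the polynomials vanishing on it vanish on all points. -/
lemma exists_generic_point : ∃ φ : MvPolynomial (Fin 6) ℚ →+* EntryClosure,
    (∀ f, φ (entriesHom f) = algebraMap EntryRing EntryClosure f) ∧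
    ∀ F, φ F = 0 → ∀ (B : Type) [CommRing B] (ψ : MvPolynomial (Fin 6) ℚ →+* B),
      SatisfiesSurfaceEquations (fun i => ψ (MvPolynomial.X i)) → ψ F = 0 := by
  obtain ⟨x, hx⟩ : ∃ x : EntryClosure, aeval x genericCharpoly = 0 := by
    obtain ⟨x, hx⟩ := IsAlgClosed.exists_aeval_eq_zero EntryClosure
      (genericCharpoly.map (algebraMap EntryRing EntryField))
      irreducible_genericCharpoly.degree_pos.ne'
    exact ⟨x, by rwa [aeval_map_algebraMap] at hx⟩
  obtain ⟨y, hy⟩ : ∃ y : EntryClosure,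
      y ^ 2 + x * y + x ^ 2 = algebraMap EntryRing EntryClosure sumSq := by
    obtain ⟨y, hy⟩ := IsAlgClosed.exists_root
      (X ^ 2 + C x * X + C (x ^ 2 - algebraMap EntryRing EntryClosure sumSq)) (by
        have : (X ^ 2 + C x * X + C (x ^ 2 - algebraMap EntryRing EntryClosure sumSq)).degree
          = 2 := by compute_degree!
        rw [this]
        decide)
    refine ⟨y, ?_⟩
    simp only [IsRoot, eval_add, eval_pow, eval_X, eval_mul, eval_C] at hy
    linear_combination hy
  set ι := algebraMap EntryRing EntryClosure with hι
  set φ : MvPolynomial (Fin 6) ℚ →+* EntryClosure :=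
    MvPolynomial.eval₂Hom (ι.comp MvPolynomial.C) ![x, y, -x - y, ι (MvPolynomial.X 0),
      ι (MvPolynomial.X 1), ι (MvPolynomial.X 2)] with hφ
  have hX : ∀ i, φ (MvPolynomial.X i) = ![x, y, -x - y, ι (MvPolynomial.X 0),
      ι (MvPolynomial.X 1), ι (MvPolynomial.X 2)] i := fun i => by
    rw [hφ, MvPolynomial.eval₂Hom_X']
  have hent : ∀ f, φ (entriesHom f) = ι f := by
    intro f
    have : φ.comp entriesHom.toRingHom = ι := by
      apply MvPolynomial.ringHom_ext
      · intro r
        exact congrArg (fun g : ℚ →+* EntryClosure => g r) (Subsingleton.elim _ _ :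
          (φ.comp entriesHom.toRingHom).comp MvPolynomial.C = ι.comp MvPolynomial.C)
      · intro i
        fin_cases i <;> simp [entriesHom, hφ]
    exact congrArg (fun g : EntryRing →+* EntryClosure => g f) this
  have hsat : SatisfiesSurfaceEquations (fun i => φ (MvPolynomial.X i)) := by
    have hx' : x ^ 3 - ι sumSq * x = ι twiceProd := by
      simp only [genericCharpoly, map_sub, map_mul, map_pow, aeval_X, aeval_C] at hx
      linear_combination hx
    simp only [sumSq, twiceProd, map_add, map_mul, map_pow, map_ofNat] at hx' hy
    refine ⟨?_, ?_, ?_⟩ <;> simp only [hX, Matrix.cons_val]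
    · ring
    · linear_combination -hy
    · linear_combination hx' - x * hy
  refine ⟨φ, hent, fun F hF B _ ψ hψ => ?_⟩
  obtain ⟨f₀, f₁, f₂, g₀, g₁, g₂, h⟩ := hasNormalForm F
  have h1 := h EntryClosure φ hsat
  simp only [hF, hent, hX, Matrix.cons_val] at h1
  obtain ⟨⟨rfl, rfl, rfl⟩, rfl, rfl, rfl⟩ := coeffs_eq_zero_of_cubicQuadraticForm hx hy h1.symm
  rw [h B ψ hψ]
  simp [cubicQuadraticForm]

/-- A polynomial that does not vanish on the whole surface divides, modulo the equations of the
surface, a nonzero polynomial in `a, b, c`. -/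
lemma exists_eliminant {F : MvPolynomial (Fin 6) ℚ} {B : Type} [CommRing B]
    {ψ : MvPolynomial (Fin 6) ℚ →+* B}
    (hψ : SatisfiesSurfaceEquations (fun i => ψ (MvPolynomial.X i))) (hF : ψ F ≠ 0) :
    ∃ (G : MvPolynomial (Fin 3) ℚ) (H : MvPolynomial (Fin 6) ℚ), G ≠ 0 ∧
      ∀ v : Fin 6 → ℚ, SatisfiesSurfaceEquations v →
        MvPolynomial.eval ![v 3, v 4, v 5] G = MvPolynomial.eval v F * MvPolynomial.eval v H := by
  obtain ⟨φ, hent, hφ⟩ := exists_generic_point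
  have hF0 : φ F ≠ 0 := fun h => hF (hφ F h B ψ hψ)
  have halg : IsAlgebraic EntryRing (φ F) :=
    (IsFractionRing.isAlgebraic_iff EntryRing EntryField EntryClosure).2
      (Algebra.IsAlgebraic.isAlgebraic (φ F))
  -- From `q(F) = 0` with `q(0) ≠ 0`, the constant term `q(0)` is `F` times `-q.divX(F)` at the
  -- generic point, hence at every point.
  obtain ⟨q, hq0, hq⟩ := halg.exists_nonzero_coeff_and_aeval_eq_zero
    (mem_nonZeroDivisors_of_ne_zero hF0)
  set H := q.divX.eval₂ entriesHom.toRingHom F with hH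
  have hφH : φ H = aeval (φ F) q.divX := by
    rw [hH, hom_eval₂, aeval_def]
    exact congrArg (fun g => eval₂ g (φ F) q.divX) (RingHom.ext hent)
  refine ⟨q.coeff 0, -H, hq0, fun v hv => ?_⟩
  have hzero : φ (F * H + entriesHom (q.coeff 0)) = 0 := by
    rw [map_add, map_mul, hφH, hent, ← hq]
    conv_rhs => rw [← divX_mul_X_add q]
    rw [map_add, map_mul, aeval_X, aeval_C, mul_comm]
  have h1 := hφ _ hzero ℚ (MvPolynomial.eval v) (by simpa using hv)
  have h2 : MvPolynomial.eval v (entriesHom (q.coeff 0)) =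
      MvPolynomial.eval ![v 3, v 4, v 5] (q.coeff 0) := by
    have : (MvPolynomial.eval v).comp entriesHom.toRingHom =
        MvPolynomial.eval ![v 3, v 4, v 5] := by
      apply MvPolynomial.ringHom_ext
      · intro r
        simp [entriesHom]
      · intro i
        fin_cases i <;> simp [entriesHom]
    exact congrArg (fun g : EntryRing →+* ℚ => g (q.coeff 0)) this
  rw [map_add, map_mul, h2] at h1
  rw [map_neg]
  linear_combination h1

end Eliminant

/-! ### Zariski density of the rational points -/

section Density

open Polynomial

lemma aeval_smul_of_isHomogeneous {σ B : Type*} [CommRing B] [Algebra ℚ B]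
    {G : MvPolynomial σ ℚ} {d : ℕ} (hG : G.IsHomogeneous d) (c : B) (v : σ → B) :
    MvPolynomial.aeval (fun i => c * v i) G = c ^ d * MvPolynomial.aeval v G := by
  rw [MvPolynomial.aeval_def, MvPolynomial.aeval_def, MvPolynomial.eval₂_eq,
    MvPolynomial.eval₂_eq, Finset.mul_sum]
  refine Finset.sum_congr rfl fun e he => ?_
  have hd : ∑ i ∈ e.support, e i = d := by
    have := hG (MvPolynomial.mem_support_iff.1 he)
    simpa [Finsupp.weight_apply, Finsupp.sum] using this
  simp only [mul_pow]
  rw [Finset.prod_mul_distrib, Finset.prod_pow_eq_pow_sum, hd]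
  ring

lemma aeval_rat_eq_eval {σ : Type*} (v : σ → ℚ) (G : MvPolynomial σ ℚ) :
    MvPolynomial.aeval v G = MvPolynomial.eval v G :=
  congrFun (MvPolynomial.aeval_eq_eval v) G

/-- Along the line through `v`, `G` is a polynomial in `s` whose coefficients are the values of its
components at `v`. -/
lemma eval_homogeneousComponent_eq_zero {σ : Type*} {G : MvPolynomial σ ℚ} {v : σ → ℚ}
    (h : ∀ s : ℚ, s ≠ 0 → MvPolynomial.eval (fun i => s * v i) G = 0) (d : ℕ) :
    MvPolynomial.eval v (MvPolynomial.homogeneousComponent d G) = 0 := by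
  set q : ℚ[X] := ∑ i ∈ Finset.range (G.totalDegree + 1),
    C (MvPolynomial.eval v (MvPolynomial.homogeneousComponent i G)) * X ^ i with hq
  have hev : ∀ s, q.eval s = MvPolynomial.eval (fun i => s * v i) G := by
    intro s
    conv_rhs => rw [← MvPolynomial.sum_homogeneousComponent G]
    rw [map_sum, hq, eval_finsetSum]
    refine Finset.sum_congr rfl fun i _ => ?_
    have := aeval_smul_of_isHomogeneous (MvPolynomial.homogeneousComponent_isHomogeneous i G) s v
    rw [aeval_rat_eq_eval, aeval_rat_eq_eval] at this
    rw [this]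
    simp only [eval_mul, eval_C, eval_pow, eval_X]
    rw [mul_comm]
  have hq0 : q = 0 := by
    refine eq_zero_of_infinite_isRoot q (Set.Infinite.mono (s := {0}ᶜ) (fun s hs => ?_)
      (Set.finite_singleton 0).infinite_compl)
    exact (hev s).trans (h s hs)
  by_cases hd : d ∈ Finset.range (G.totalDegree + 1)
  · have := congrArg (coeff · d) hq0
    simpa [hq, coeff_X_pow, hd] using this
  · rw [MvPolynomial.homogeneousComponent_eq_zero _ _ (by simpa using hd), map_zero]

lemma map_aeval_vec {B B' : Type*} [CommRing B] [CommRing B'] [Algebra ℚ B] [Algebra ℚ B']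
    (f : B →+* B') (a b c : B) (G : MvPolynomial (Fin 3) ℚ) :
    f (MvPolynomial.aeval ![a, b, c] G) = MvPolynomial.aeval ![f a, f b, f c] G := by
  have h := MvPolynomial.comp_aeval_apply (f := ![a, b, c]) f.toRatAlgHom G
  rw [RingHom.toRatAlgHom_apply] at h
  rw [h]
  congr 2
  funext i
  fin_cases i <;> rfl

/-- Take `t = x / a` for a real eigenvalue `x > a`, found by the intermediate value theorem on `[a,
a + b + c]`. Then `t > 1` and `t * conicA t ν = (tν - 1)² + t² - 1 > 0`. -/
lemma exists_real_conic {a b c : ℝ} (ha : 0 < a) (hb : 0 < b) (hc : 0 < c) :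
    ∃ t ν : ℝ, 0 < conicA t ν ∧ b * conicA t ν = conicB t ν * a ∧
      c * conicA t ν = conicC t ν * a := by
  obtain ⟨x, ⟨hx1, -⟩, hx⟩ : ∃ x ∈ Set.Icc a (a + b + c),
      x ^ 3 - (a ^ 2 + b ^ 2 + c ^ 2) * x - 2 * a * b * c = 0 := by
    have hcont : ContinuousOn (fun x : ℝ => x ^ 3 - (a ^ 2 + b ^ 2 + c ^ 2) * x - 2 * a * b * c)
        (Set.Icc a (a + b + c)) := by fun_prop
    refine intermediate_value_Icc (by linarith) hcont ⟨?_, ?_⟩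
    · have : 0 ≤ a * (b + c) ^ 2 := by positivity
      linarith
    · have : 0 ≤ 2 * (a + b + c) * (a * b + b * c + c * a) - 2 * a * b * c := by
        have : 2 * (a + b + c) * (a * b + b * c + c * a) - 2 * a * b * c =
          2 * (a * (a * b + b * c + c * a) + b * (a * b + b * c + c * a) +
            c * (b * c + c * a)) := by ring
        rw [this]
        positivity
      linarith
  have hxa : a < x := by
    refine lt_of_le_of_ne hx1 ?_
    rintro rfl
    have : 0 < a * (b + c) ^ 2 := by positivity
    linarith
  set t := x / a with ht
  have hta : t * a = x := div_mul_cancel₀ _ ha.ne'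
  have ht1 : 1 < t := (one_lt_div ha).2 hxa
  set ν := (x - c) / (a + b) with hν
  have hν' : ν * (a + b) = t * a - c := by
    rw [hta]
    exact div_mul_cancel₀ _ (by positivity)
  refine ⟨t, ν, ?_, conic_of_fibre ?_ hν' (by positivity)⟩
  · have : 0 < t * conicA t ν := by
      unfold conicA
      nlinarith [sq_nonneg (t * ν - 1)]
    exact pos_of_mul_pos_right this (by linarith)
  · apply mul_left_cancel₀ ha.ne'
    rw [← hta] at hx
    linear_combination hx

lemma infinite_setOf_eval_ne_zero {f : ℤ[X]} (hf : f ≠ 0) : {m : ℤ | f.eval m ≠ 0}.Infinite :=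
  (finite_eval_eq_zero hf).infinite_compl

/-- Vanishing at infinitely many integers `m` gives `G(a, b, c) = 0` in `ℚ[t]`; homogeneity carries
this to the proportional triple `(conicA, conicB, conicC)`. -/
lemma aeval_conic_eq_zero_of_isHomogeneous {G : MvPolynomial (Fin 3) ℚ} {d : ℕ}
    (hG : G.IsHomogeneous d)
    (h : ∀ v : Fin 6 → ℚ, v ≠ 0 → SatisfiesSurfaceEquations v →
      MvPolynomial.eval ![v 3, v 4, v 5] G = 0)
    {n : ℤ} (hn : n ≠ 0) {p : Fin 6 → ℤ[X]} (hp : ParametrizesMultiple n p) :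
    MvPolynomial.aeval ![conicA tt (nuOf fun i => ofIntPoly (p i)),
      conicB tt (nuOf fun i => ofIntPoly (p i)), conicC tt (nuOf fun i => ofIntPoly (p i))] G
      = 0 := by
  obtain ⟨ha, hb, hc⟩ := hp.conic hn rfl
  set ν := nuOf fun i => ofIntPoly (p i)
  set P : Fin 6 → ℚ[X] := fun i => (p i).map (Int.castRingHom ℚ) with hP
  have h0 : MvPolynomial.aeval ![P 3, P 4, P 5] G = 0 := by
    have hp3 : p 3 ≠ 0 := by
      intro h3
      rw [h3, map_zero] at ha
      exact ha rfl
    refine eq_zero_of_infinite_isRoot _ (Set.Infinite.mono ?_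
      ((infinite_setOf_eval_ne_zero hp3).image (Int.cast_injective (α := ℚ)).injOn))
    rintro _ ⟨m, hm, rfl⟩
    rw [Set.mem_ofPred_eq, IsRoot, ← coe_evalRingHom, map_aeval_vec, aeval_rat_eq_eval]
    have he : ∀ i, evalRingHom (m : ℚ) (P i) = ((p i).eval m : ℤ) := fun i => by
      simp [hP]
    refine h (fun i => evalRingHom (m : ℚ) (P i)) ?_ ?_
    · intro h1
      apply hm
      have := congrFun h1 3
      rw [he, Pi.zero_apply] at this
      exact_mod_cast this
    · simp only [he]
      exact (hp.on_surface.eval m).map (Int.castRingHom ℚ)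
  have h1 : MvPolynomial.aeval ![ofIntPoly (p 3), ofIntPoly (p 4), ofIntPoly (p 5)] G = 0 := by
    have := congrArg ofPoly h0
    rw [map_aeval_vec, map_zero] at this
    exact this
  have h2 := aeval_smul_of_isHomogeneous hG (conicA tt ν)
    ![ofIntPoly (p 3), ofIntPoly (p 4), ofIntPoly (p 5)]
  have h3 := aeval_smul_of_isHomogeneous hG (ofIntPoly (p 3))
    ![conicA tt ν, conicB tt ν, conicC tt ν]
  rw [h1, mul_zero] at h2
  have h4 : (fun i => conicA tt ν * ![ofIntPoly (p 3), ofIntPoly (p 4), ofIntPoly (p 5)] i) =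
      fun i => ofIntPoly (p 3) * ![conicA tt ν, conicB tt ν, conicC tt ν] i := by
    funext i
    fin_cases i
    · exact mul_comm _ _
    · change conicA tt ν * ofIntPoly (p 4) = ofIntPoly (p 3) * conicB tt ν
      linear_combination hb
    · change conicA tt ν * ofIntPoly (p 5) = ofIntPoly (p 3) * conicC tt ν
      linear_combination hc
  rw [← h4, h2] at h3
  exact (mul_eq_zero.1 h3.symm).resolve_left (pow_ne_zero d ha)

/-- As a polynomial in `ν` over `ℚ(t)`, `Γ` vanishes at the `ν` of every nonzero multiple of `P`, so
it is zero and may be specialized to real values. -/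
lemma aeval_conic_eq_zero {G : MvPolynomial (Fin 3) ℚ}
    (h : ∀ (n : ℤ) (p : Fin 6 → ℤ[X]), n ≠ 0 → ParametrizesMultiple n p →
      MvPolynomial.aeval ![conicA tt (nuOf fun i => ofIntPoly (p i)),
        conicB tt (nuOf fun i => ofIntPoly (p i)),
        conicC tt (nuOf fun i => ofIntPoly (p i))] G = 0) (t ν : ℝ) :
    MvPolynomial.aeval ![conicA t ν, conicB t ν, conicC t ν] G = 0 := by
  set Γ : ℚ[X][X] := MvPolynomial.aeval ![conicA (C (X : ℚ[X])) X,
    conicB (C (X : ℚ[X])) X, conicC (C (X : ℚ[X])) X] G with hΓ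
  have hmap : Γ.map ofPoly = 0 := by
    by_contra hne
    refine Set.Infinite.mono (s := {0}ᶜ) ?_ (Set.finite_singleton (0 : ℤ)).infinite_compl
      (finite_multiples_of_eval_nu hne)
    intro n hn
    obtain ⟨p, hp⟩ := exists_parametrizesMultiple n
    refine ⟨hn, p, hp, ?_⟩
    rw [eval_map, ← coe_eval₂RingHom, hΓ, map_aeval_vec, map_conicA, map_conicB, map_conicC,
      coe_eval₂RingHom, eval₂_X, eval₂_C, ofPoly_X]
    exact h n p hn hp
  have hΓ0 : Γ = 0 := map_injective _ ofPoly_injective (by rw [hmap, Polynomial.map_zero])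
  have := congrArg (eval₂RingHom (eval₂RingHom (algebraMap ℚ ℝ) t) ν) hΓ0
  rw [hΓ, map_aeval_vec, map_conicA, map_conicB, map_conicC, coe_eval₂RingHom, eval₂_X, eval₂_C,
    coe_eval₂RingHom, eval₂_X, eval₂_zero] at this
  exact this

lemma eq_zero_of_vanishes_of_isHomogeneous {G : MvPolynomial (Fin 3) ℚ} {d : ℕ}
    (hG : G.IsHomogeneous d)
    (h : ∀ v : Fin 6 → ℚ, v ≠ 0 → SatisfiesSurfaceEquations v →
      MvPolynomial.eval ![v 3, v 4, v 5] G = 0) : G = 0 := by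
  have hconic := aeval_conic_eq_zero
    fun n p hn hp => aeval_conic_eq_zero_of_isHomogeneous hG h hn hp
  refine MvPolynomial.funext_set (fun _ => Set.Ioi (0 : ℚ)) (fun _ => Set.Ioi_infinite 0)
    fun w hw => ?_
  rw [map_zero]
  have hw' : ∀ i, (0 : ℝ) < w i := fun i => by exact_mod_cast hw i (Set.mem_univ i)
  obtain ⟨t, ν, hA, hB, hC⟩ := exists_real_conic (hw' 0) (hw' 1) (hw' 2)
  have h1 := aeval_smul_of_isHomogeneous hG (conicA t ν) ![(w 0 : ℝ), (w 1 : ℝ), (w 2 : ℝ)]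
  have h2 := aeval_smul_of_isHomogeneous hG (w 0 : ℝ) ![conicA t ν, conicB t ν, conicC t ν]
  have h3 : (fun i => conicA t ν * ![(w 0 : ℝ), (w 1 : ℝ), (w 2 : ℝ)] i) =
      fun i => (w 0 : ℝ) * ![conicA t ν, conicB t ν, conicC t ν] i := by
    funext i
    fin_cases i
    · exact mul_comm _ _
    · change conicA t ν * (w 1 : ℝ) = w 0 * conicB t ν
      linear_combination hB
    · change conicA t ν * (w 2 : ℝ) = w 0 * conicC t ν
      linear_combination hC
  rw [← h3, hconic, mul_zero] at h2
  rw [h2] at h1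
  have h4 := (mul_eq_zero.1 h1.symm).resolve_left (pow_ne_zero d hA.ne')
  have h5 := map_aeval_vec (algebraMap ℚ ℝ) (w 0) (w 1) (w 2) G
  simp only [eq_ratCast] at h5
  rw [h4] at h5
  have h6 : ![w 0, w 1, w 2] = w := by
    funext i
    fin_cases i <;> rfl
  rw [h6, aeval_rat_eq_eval] at h5
  exact_mod_cast h5

lemma eq_zero_of_vanishes {G : MvPolynomial (Fin 3) ℚ}
    (h : ∀ v : Fin 6 → ℚ, v ≠ 0 → SatisfiesSurfaceEquations v →
      MvPolynomial.eval ![v 3, v 4, v 5] G = 0) : G = 0 := by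
  rw [← MvPolynomial.sum_homogeneousComponent G]
  refine Finset.sum_eq_zero fun d _ => ?_
  refine eq_zero_of_vanishes_of_isHomogeneous
    (MvPolynomial.homogeneousComponent_isHomogeneous d G) fun v hv hs => ?_
  refine eval_homogeneousComponent_eq_zero (fun s hs0 => ?_) d
  have h1 := h (fun i => s * v i) ?_ (hs.smul s)
  · convert h1 using 2
    congr 1
    funext i
    fin_cases i <;> rfl
  · intro h0
    apply hv
    funext i
    exact (mul_eq_zero.1 (congrFun h0 i)).resolve_left hs0

lemma rationalPoint_mem_surfaceX {v : Fin 6 → ℚ} (hv : v ≠ 0)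
    (h : SatisfiesSurfaceEquations v) : rationalPoint v hv ∈ surfaceX := by
  obtain ⟨h1, h2, h3⟩ := h
  rw [surfaceX, ProjectiveSpectrum.mem_zeroLocus]
  rintro F (rfl | rfl | rfl)
  · refine Ideal.subset_span ⟨⟨1, ?_⟩, by simpa using h1⟩
    exact ((MvPolynomial.isHomogeneous_X _ _).add (MvPolynomial.isHomogeneous_X _ _)).add
      (MvPolynomial.isHomogeneous_X _ _)
  · refine Ideal.subset_span ⟨⟨2, ?_⟩, ?_⟩
    · have hX := fun i => MvPolynomial.isHomogeneous_X ℚ (i : Fin 6)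
      exact (((((hX 0).mul (hX 1)).add ((hX 1).mul (hX 2))).add ((hX 2).mul (hX 0))).add
        ((hX 3).pow 2)).add ((hX 4).pow 2) |>.add ((hX 5).pow 2)
    · simp only [map_add, map_mul, map_pow, MvPolynomial.eval_X]
      linear_combination h2
  · refine Ideal.subset_span ⟨⟨3, ?_⟩, ?_⟩
    · have hX := fun i => MvPolynomial.isHomogeneous_X ℚ (i : Fin 6)
      refine (((hX 0).mul (hX 1)).mul (hX 2)).sub ?_
      have h2 : (2 : MvPolynomial (Fin 6) ℚ).IsHomogeneous 0 := MvPolynomial.isHomogeneous_C _ 2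
      exact ((h2.mul (hX 3)).mul (hX 4)).mul (hX 5)
    · simp only [map_sub, map_mul, MvPolynomial.eval_X, map_ofNat]
      linear_combination h3

lemma satisfiesSurfaceEquations_of_mem_surfaceX {P : ProjFive} (hP : P ∈ surfaceX) :
    SatisfiesSurfaceEquations
      (fun i => Ideal.Quotient.mk P.asHomogeneousIdeal.toIdeal (MvPolynomial.X i)) := by
  rw [surfaceX, ProjectiveSpectrum.mem_zeroLocus] at hP
  have key : ∀ F ∈ P.asHomogeneousIdeal.toIdeal,
      Ideal.Quotient.mk P.asHomogeneousIdeal.toIdeal F = 0 :=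
    fun F hF => Ideal.Quotient.eq_zero_iff_mem.2 hF
  have h1 := key _ (hP (Or.inl rfl))
  have h2 := key _ (hP (Or.inr (Or.inl rfl)))
  have h3 := key _ (hP (Or.inr (Or.inr rfl)))
  simp only [map_add, map_sub, map_mul, map_pow, map_ofNat] at h1 h2 h3
  exact ⟨h1, by linear_combination h2, by linear_combination h3⟩

lemma dense_rationalPoints : Dense {p : ↥surfaceX | IsRationalPoint p.1} := by
  rw [dense_iff_inter_open]
  rintro U hU ⟨⟨P, hP⟩, hPU⟩
  obtain ⟨V, hV, rfl⟩ := isOpen_induced_iff.1 hU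
  obtain ⟨_, ⟨F, rfl⟩, hPF, hFV⟩ :=
    (ProjectiveSpectrum.isTopologicalBasis_basic_opens
      (MvPolynomial.homogeneousSubmodule (Fin 6) ℚ)).exists_subset_of_mem_open hPU hV
  have hF : Ideal.Quotient.mk P.asHomogeneousIdeal.toIdeal F ≠ 0 :=
    fun h => hPF (Ideal.Quotient.eq_zero_iff_mem.1 h)
  obtain ⟨G, H, hG0, hG⟩ := exists_eliminant (satisfiesSurfaceEquations_of_mem_surfaceX hP) hF
  obtain ⟨v, hv, hs, hFv⟩ : ∃ v : Fin 6 → ℚ, v ≠ 0 ∧ SatisfiesSurfaceEquations v ∧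
      MvPolynomial.eval v F ≠ 0 := by
    by_contra! hcon
    exact hG0 (eq_zero_of_vanishes fun v hv hs => by rw [hG v hs, hcon v hv hs, zero_mul])
  refine ⟨⟨rationalPoint v hv, rationalPoint_mem_surfaceX hv hs⟩, hFV ?_, v, hv, rfl⟩
  intro hmem
  exact hFv (eval_eq_zero_of_mem_pointIdeal hmem)

end Density

theorem mainTheorem1 :
    -- the rational points on the surface are Zariski dense in it
    Dense {p : ↥surfaceX | IsRationalPoint p.1} ∧
    -- there are infinitely many nontrivial matrices, even up to scaling
    {M : Matrix (Fin 3) (Fin 3) ℤ |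
      IsNontrivialIntegralMatrix M ∧ IsPrimitiveMatrix M}.Infinite ∧
    -- `P` is the section `t ↦ [t² : 2 - t² : -2 : t : t² - 2 : t]`; its multiples are distinct
    ParametrizesMultiple 1
      ![Polynomial.X ^ 2, 2 - Polynomial.X ^ 2, -2, Polynomial.X, Polynomial.X ^ 2 - 2,
        Polynomial.X] ∧
    Function.Injective (fun n : ℤ => n • sectionP) ∧
    -- each multiple of `P` is a rational curve parametrized by integral polynomials
    (∀ n : ℤ, ∃ p : Fin 6 → Polynomial ℤ, ParametrizesMultiple n p) ∧
    -- which gives matrices whose eigenvalues are the integers `x(m)`, `y(m)`, `z(m)`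
    (∀ (n : ℤ) (p : Fin 6 → Polynomial ℤ), ParametrizesMultiple n p → ∀ m : ℤ,
      (specializedMatrix p m).charpoly =
        (Polynomial.X - Polynomial.C ((p 0).eval m)) *
        (Polynomial.X - Polynomial.C ((p 1).eval m)) *
        (Polynomial.X - Polynomial.C ((p 2).eval m))) ∧
    -- for all but finitely many multiples, almost all of these matrices are nontrivial,
    -- and up to scaling they are infinitely many
    (∃ S : Set ℤ, S.Finite ∧ ∀ n : ℤ, n ∉ S → ∀ p : Fin 6 → Polynomial ℤ,
      ParametrizesMultiple n p →
        {m : ℤ | ¬ IsNontrivialIntegralMatrix (specializedMatrix p m)}.Finite ∧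
        {M : Matrix (Fin 3) (Fin 3) ℤ | IsNontrivialIntegralMatrix M ∧ IsPrimitiveMatrix M ∧
          ∃ m k : ℤ, k ≠ 0 ∧ specializedMatrix p m = k • M}.Infinite) := by
  have hfin : {n : ℤ | n ≠ 0 ∧ ∃ p : Fin 6 → Polynomial ℤ, ParametrizesMultiple n p ∧
      trivialityPoly (p 3) (p 4) (p 5) = 0}.Finite := finite_trivial_multiples
  have hlast : ∃ S : Set ℤ, S.Finite ∧ ∀ n : ℤ, n ∉ S → ∀ p : Fin 6 → Polynomial ℤ,
      ParametrizesMultiple n p →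
        {m : ℤ | ¬ IsNontrivialIntegralMatrix (specializedMatrix p m)}.Finite ∧
        {M : Matrix (Fin 3) (Fin 3) ℤ | IsNontrivialIntegralMatrix M ∧ IsPrimitiveMatrix M ∧
          ∃ m k : ℤ, k ≠ 0 ∧ specializedMatrix p m = k • M}.Infinite := by
    -- `n = 0` is excluded separately, since `a + b = 0` on the zero section and `ν` has no meaning
    -- there.
    refine ⟨insert 0 _, hfin.insert 0, fun n hn p hp => ?_⟩
    rw [Set.mem_insert_iff, not_or] at hn
    have h0 : trivialityPoly (p 3) (p 4) (p 5) ≠ 0 := fun h => hn.2 ⟨hn.1, p, hp, h⟩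
    exact ⟨finite_trivial_specializations hp.on_surface h0,
      infinite_primitive_of_nontrivial hp.on_surface hp.on_fibre₁ h0⟩
  refine ⟨dense_rationalPoints, ?_, parametrizesMultiple_one, injective_zsmul_sectionP,
    exists_parametrizesMultiple, fun n p hp => charpoly_specializedMatrix hp.on_surface, hlast⟩
  obtain ⟨S, hS, h⟩ := hlast
  obtain ⟨n, hn⟩ := hS.exists_notMem
  obtain ⟨p, hp⟩ := exists_parametrizesMultiple n
  exact (h n hn p hp).2.mono fun M hM => ⟨hM.1, hM.2.1⟩
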